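/- Let $E$ be a Polish space with Borel $\sigma$-algebra $\mathcal E$, and let $P(x,dy)$ be a Markov transition kernel on $E$ with $n$-step kernels $P_n$; for $x\in E$ let $\mathbb P_x$ be the law on $E^\infty=E^{\{0,1,2,\dots\}}$ of the chain started at $x$. Let $d$ be a metric on $E$ which is bounded and continuous on $E\times E$ for the given topology of $E$ ($d$ need not be complete and need not generate this topology). The chain is called $d$-Feller if $x\mapsto\int f(y)\,P(x,dy)$ is $d$-continuous for every bounded $d$-continuous $f:E\to\mathbb R$. For probability measures $\mu,\nu$ on a measurable space $S$ let $C(\mu,\nu)$ be the set of probability measures $\xi$ on $S\times S$ with marginals $\pi_1(\xi)=\mu$, $\pi_2(\xi)=\nu$, let $\widehat C(\mu,\nu)$ be the set of those with $\pi_1(\xi)\ll\mu$, $\pi_2(\xi)\ll\nu$, and for $p>1$, $R\ge1$ let $\widehat C_p^R(\mu,\nu)$ be the set of $\xi\in\widehat C(\mu,\nu)$ with $$\Big(\int\Big(\frac{d\pi_1(\xi)}{d\mu}\Big)^p d\mu\Big)^{1/p}\le R,\qquad \Big(\int\Big(\frac{d\pi_2(\xi)}{d\nu}\Big)^p d\nu\Big)^{1/p}\le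 R .$$ For probability measures on $E$ put $d(\mu,\nu)=\inf_{\eta\in C(\mu,\nu)}\int d(x,y)\,\eta(dx,dy)$. Write $(X_n,Y_n)_{n\ge0}$ for the coordinates on $E^\infty\times E^\infty$. For $x,y\in E$ consider the conditions (i) $\displaystyle\lim_{\varepsilon\downarrow0}\liminf_{n\to\infty}\sup_{\xi\in C(\mathbb P_x,\mathbb P_y)}\xi\big(d(X_n,Y_n)\le\varepsilon\big)>0$; (ii) for some $p>1$ and $R\ge1$, $\displaystyle\lim_{\varepsilon\downarrow0}\liminf_{n\to\infty}\sup_{\xi\in\widehat C_p^R(\mathbb P_x,\mathbb P_y)}\xi\big(d(X_n,Y_n)\le\varepsilon\big)>0$; (iii) $\displaystyle\sup_{\xi\in\widehat C(\mathbb P_x,\mathbb P_y)}\lim_{\varepsilon\downarrow0}\liminf_{n\to\infty}\xi\big(d(X_n,Y_n)\le\varepsilon\big)>0$. I. Suppose that the chain is $d$-Feller, that $\mu$ is an invariant probability measure, and that there is $M\in\mathcal E\otimes\mathcal E$ with $(\mu\otimes\mu)(M)=1$ such that (i) holds for every $(x,y)\in M$. Then for every $\varepsilon>0$ $$\mu\big(\{x: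 d(P_n(x,\cdot),\mu)>\varepsilon\}\big)\to0\qquad(n\to\infty).$$ II. For all $x,y\in E$, condition (i) is equivalent to condition (ii), and condition (iii) implies (ii) and (i). -/

import Mathlib

open MeasureTheory ProbabilityTheory Filter Topology
open scoped ENNReal

noncomputable section

namespace GenCoupling

/-- `d` is a metric on the set `E`; the topology of `E` need not be the one given by `d`. -/
structure IsMetric {E : Type*} (d : E → E → ℝ) : Prop where
  eq_zero_iff : ∀ x y, d x y = 0 ↔ x = y
  symm : ∀ x y, d x y = d y x
  triangle : ∀ x y z, d x z ≤ d x y + d y z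

/-- Continuity of a real function with respect to the metric `d`. -/
def DContinuous {E : Type*} (d : E → E → ℝ) (f : E → ℝ) : Prop :=
  ∀ x, ∀ ε > 0, ∃ δ > 0, ∀ y, d x y < δ → |f y - f x| < ε

section Couplings

variable {S : Type*} [MeasurableSpace S]

/-- The couplings `C(μ, ν)`. -/
def couplings (μ ν : Measure S) : Set (Measure (S × S)) :=
  {ξ | IsProbabilityMeasure ξ ∧ ξ.fst = μ ∧ ξ.snd = ν}

/-- The generalized couplings `Ĉ(μ, ν)`. -/
def genCouplings (μ ν : Measure S) : Set (Measure (S × S)) :=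
  {ξ | IsProbabilityMeasure ξ ∧ ξ.fst ≪ μ ∧ ξ.snd ≪ ν}

/-- The generalized couplings `Ĉ_p^R(μ, ν)`, whose marginal densities have `L^p` norm at
most `R`. -/
def genCouplingsLp (p R : ℝ) (μ ν : Measure S) : Set (Measure (S × S)) :=
  {ξ | ξ ∈ genCouplings μ ν ∧
    (∫⁻ s, (ξ.fst.rnDeriv μ s) ^ p ∂μ) ^ (1 / p) ≤ ENNReal.ofReal R ∧
    (∫⁻ s, (ξ.snd.rnDeriv ν s) ^ p ∂ν) ^ (1 / p) ≤ ENNReal.ofReal R}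

/-- The minimal (coupling, Kantorovich-Rubinshtein) distance associated with `d`. -/
def minimalDist (d : S → S → ℝ) (μ ν : Measure S) : ℝ≥0∞ :=
  ⨅ η ∈ couplings μ ν, ∫⁻ z, ENNReal.ofReal (d z.1 z.2) ∂η

end Couplings

section Chain

variable {E : Type*} [MeasurableSpace E]

/-- The `n`-step transition probabilities. -/
def nStep (P : Kernel E E) : ℕ → Kernel E E
  | 0 => Kernel.id
  | n + 1 => P ∘ₖ nStep P n

/-- The law on the trajectory space of the Markov chain with transition kernel `P` started
at `x`. -/
def pathLaw (P : Kernel E E) [IsMarkovKernel P] (x : E) : Measure (ℕ → E) :=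
  Kernel.trajMeasure (X := fun _ => E) (Measure.dirac x)
    (fun n => P.comap (fun h : (i : Finset.Iic n) → E => h ⟨n, Finset.mem_Iic.2 le_rfl⟩)
      (measurable_pi_apply _))

/-- The chain is `d`-Feller. -/
def IsDFeller (d : E → E → ℝ) (P : Kernel E E) : Prop :=
  ∀ f : E → ℝ, (∃ C, ∀ x, |f x| ≤ C) → DContinuous d f →
    DContinuous d (fun x => ∫ y, f y ∂(P x))

/-- The event `d(X_n, Y_n) ≤ ε` for a pair of trajectories. -/
def closeAt (d : E → E → ℝ) (n : ℕ) (ε : ℝ) : Set ((ℕ → E) × (ℕ → E)) :=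
  {ω | d (ω.1 n) (ω.2 n) ≤ ε}

/-- `lim_{ε ↓ 0} g ε`; it is only used for monotone `g`, for which the limit exists
(`tendsto_limZero`). -/
def limZero (g : ℝ → ℝ≥0∞) : ℝ≥0∞ :=
  limUnder (𝓝[>] (0 : ℝ)) g

theorem tendsto_limZero {g : ℝ → ℝ≥0∞} (hg : Monotone g) :
    Tendsto g (𝓝[>] (0 : ℝ)) (𝓝 (limZero g)) :=
  tendsto_nhds_limUnder ⟨_, hg.tendsto_nhdsGT 0⟩

/-- The condition over true couplings at the pair of initial points `(x, y)`. -/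
def CouplingCond (d : E → E → ℝ) (P : Kernel E E) [IsMarkovKernel P] (x y : E) : Prop :=
  0 < limZero fun ε => liminf
    (fun n : ℕ => ⨆ ξ ∈ couplings (pathLaw P x) (pathLaw P y), ξ (closeAt d n ε)) atTop

/-- The condition over generalized couplings with `L^p` densities bounded by `R`. -/
def LpCouplingCond (d : E → E → ℝ) (P : Kernel E E) [IsMarkovKernel P] (p R : ℝ) (x y : E) :
    Prop :=
  0 < limZero fun ε => liminf
    (fun n : ℕ => ⨆ ξ ∈ genCouplingsLp p R (pathLaw P x) (pathLaw P y), ξ (closeAt d n ε)) atTop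

/-- The condition over all generalized couplings, with the supremum outside the limits. -/
def GenCouplingCond (d : E → E → ℝ) (P : Kernel E E) [IsMarkovKernel P] (x y : E) : Prop :=
  0 < ⨆ ξ ∈ genCouplings (pathLaw P x) (pathLaw P y),
    limZero fun ε => liminf (fun n : ℕ => ξ (closeAt d n ε)) atTop

end Chain

end GenCoupling

end

namespace GenCoupling

/-! Part II is a truncation argument. Restrict a generalized coupling to the rectangle where both
marginal densities are at most `N` and divide by `N`: the marginals now lie below the prescribed
laws, so the result extends to a true coupling (`exists_coupling_ge`). Only the density tails are
lost. They are uniformly small under an `L^p` bound with `p > 1`, and small at some level for any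
single generalized coupling.

Part I rests on the loss of `L²` norm along the semigroup. For bounded `d`-continuous `f` the
numbers `v m = ∫ (P_m f)² dμ` decrease to a limit, and `v m - v (m + n)` is the `μ`-mean of the
variance of `P_m f` under `P_n(x, ·)` (`integral_condVar_nStep`). So for large `m`, uniformly in
`n`, `P_m f` is in mean almost equal to the constant `P_{m+n} f(x)` under `P_n(x, ·)`. If a coupling
of `P_n(x, ·)` and `P_n(y, ·)` gives mass `a` to close pairs, then, `P_m f` being `d`-continuous by
the Feller property, the two constants must be close (`mul_sq_sub_integral_le`). Continuity is
uniform only off a set of small `μ`-measure, but invariance keeps the mean `P_n`-mass of that set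
small.

The mass `a` depends on `(x, y)`; `tendsto_lintegral_zero_of_eventually_le_mul` absorbs this.
Averaging over `y` gives `P_n f → ∫ f dμ` in `L²(μ)`. Finitely many such `f`, forming most of a
partition of unity with small supports, then control the minimal distance
(`minimalDist_le_of_partition`). -/

theorem limZero_eq_iInf {g : ℝ → ℝ≥0∞} (hg : Monotone g) : limZero g = ⨅ ε > 0, g ε := by
  rw [tendsto_nhds_unique (tendsto_limZero hg) (hg.tendsto_nhdsGT 0), sInf_image]
  rfl

/-- By monotonicity the limit is an infimum, so any `a` strictly between `0` and it serves for all
`ε` at once. This is the form in which all three conditions are used. -/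
theorem limZero_liminf_pos_iff {u : ℝ → ℕ → ℝ≥0∞} (hu : ∀ n, Monotone fun ε => u ε n) :
    0 < limZero (fun ε => liminf (u ε) atTop) ↔
      ∃ a, 0 < a ∧ a ≠ ∞ ∧ ∀ ε > 0, ∀ᶠ n in atTop, a ≤ u ε n := by
  have hm : Monotone fun ε => liminf (u ε) atTop := fun ε ε' h =>
    liminf_le_liminf (Eventually.of_forall fun n => hu n h)
  rw [limZero_eq_iInf hm]
  constructor
  · intro h
    obtain ⟨a, ha, ha'⟩ := exists_between h
    refine ⟨a, ha, ha'.ne_top, fun ε hε => ?_⟩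
    have : a < liminf (u ε) atTop := ha'.trans_le (iInf₂_le ε hε)
    exact (eventually_lt_of_lt_liminf this).mono fun n hn => hn.le
  · rintro ⟨a, ha, -, h⟩
    exact ha.trans_le (le_iInf₂ fun ε hε => le_liminf_of_le (by isBoundedDefault) (h ε hε))

/-! ### Extension and truncation of couplings. -/

section Couplings

variable {S : Type*} [MeasurableSpace S] {μ ν : Measure S}

/-- A measure whose marginals are dominated by `μ` and `ν` extends to a coupling. -/
theorem exists_coupling_ge [IsProbabilityMeasure μ] [IsProbabilityMeasure ν]
    {ζ : Measure (S × S)} (h₁ : ζ.fst ≤ μ) (h₂ : ζ.snd ≤ ν) :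
    ∃ η ∈ couplings μ ν, ζ ≤ η := by
  have hf₁ : IsFiniteMeasure ζ.fst := isFiniteMeasure_of_le μ h₁
  have hf₂ : IsFiniteMeasure ζ.snd := isFiniteMeasure_of_le ν h₂
  have e₁ : (μ - ζ.fst) Set.univ = 1 - ζ Set.univ := by
    rw [Measure.sub_apply .univ h₁, measure_univ, Measure.fst_univ]
  have e₂ : (ν - ζ.snd) Set.univ = 1 - ζ Set.univ := by
    rw [Measure.sub_apply .univ h₂, measure_univ, Measure.snd_univ]
  -- Both marginals miss the same mass `c`, so the product of the two residuals divided by `c` has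
  -- exactly these residuals as marginals. If `c = 0` the residuals vanish, and `c⁻¹ = ∞` does no
  -- harm.
  set c := 1 - ζ Set.univ with hc
  have hct : c ≠ ∞ := (tsub_le_self.trans_lt ENNReal.one_lt_top).ne
  have k₁ : (c⁻¹ * c) • (μ - ζ.fst) = μ - ζ.fst := by
    rcases eq_or_ne c 0 with h0 | h0
    · rw [h0] at e₁
      simp [Measure.measure_univ_eq_zero.1 e₁]
    · rw [ENNReal.inv_mul_cancel h0 hct, one_smul]
  have k₂ : (c⁻¹ * c) • (ν - ζ.snd) = ν - ζ.snd := by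
    rcases eq_or_ne c 0 with h0 | h0
    · rw [h0] at e₂
      simp [Measure.measure_univ_eq_zero.1 e₂]
    · rw [ENNReal.inv_mul_cancel h0 hct, one_smul]
  have m₁ : (ζ + c⁻¹ • (μ - ζ.fst).prod (ν - ζ.snd)).fst = μ := by
    have hr : (c⁻¹ • (μ - ζ.fst).prod (ν - ζ.snd)).fst = μ - ζ.fst := by
      change Measure.map _ _ = _
      rw [Measure.map_smul, Measure.map_fst_prod, e₂, smul_smul, k₁]
    rw [Measure.fst_add, hr, add_comm, Measure.sub_add_cancel_of_le h₁]
  have m₂ : (ζ + c⁻¹ • (μ - ζ.fst).prod (ν - ζ.snd)).snd = ν := by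
    have hr : (c⁻¹ • (μ - ζ.fst).prod (ν - ζ.snd)).snd = ν - ζ.snd := by
      change Measure.map _ _ = _
      rw [Measure.map_smul, Measure.map_snd_prod, e₁, smul_smul, k₂]
    rw [Measure.snd_add, hr, add_comm, Measure.sub_add_cancel_of_le h₂]
  refine ⟨_, ⟨⟨?_⟩, m₁, m₂⟩, Measure.le_add_right le_rfl⟩
  rw [← Measure.fst_univ, m₁, measure_univ]

theorem couplings_subset_genCouplingsLp [IsProbabilityMeasure μ] [IsProbabilityMeasure ν]
    {p R : ℝ} (hR : 1 ≤ R) : couplings μ ν ⊆ genCouplingsLp p R μ ν := by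
  have key : ∀ (ρ : Measure S) [IsProbabilityMeasure ρ],
      (∫⁻ s, (ρ.rnDeriv ρ s) ^ p ∂ρ) ^ (1 / p) ≤ ENNReal.ofReal R := by
    intro ρ _
    have : ∫⁻ s, (ρ.rnDeriv ρ s) ^ p ∂ρ = 1 := by
      rw [lintegral_congr_ae (g := fun _ => 1)]
      · simp
      · filter_upwards [Measure.rnDeriv_self ρ] with s hs
        simp [hs]
    rw [this, ENNReal.one_rpow]
    exact ENNReal.one_le_ofReal.2 hR
  rintro ξ ⟨hξ, rfl, rfl⟩
  exact ⟨⟨hξ, Measure.AbsolutelyContinuous.rfl, Measure.AbsolutelyContinuous.rfl⟩,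
    key _, key _⟩

theorem restrict_rnDeriv_le_le_smul {ρ μ : Measure S} [IsFiniteMeasure ρ] [SigmaFinite μ]
    (h : ρ ≪ μ) (N : ℝ≥0∞) : ρ.restrict {s | ρ.rnDeriv μ s ≤ N} ≤ N • μ := by
  have hA : MeasurableSet {s | ρ.rnDeriv μ s ≤ N} :=
    measurableSet_le (Measure.measurable_rnDeriv ρ μ) measurable_const
  refine Measure.le_iff.2 fun t ht => ?_
  rw [Measure.restrict_apply ht, ← Measure.setLIntegral_rnDeriv h]
  calc ∫⁻ s in t ∩ {s | ρ.rnDeriv μ s ≤ N}, ρ.rnDeriv μ s ∂μ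
      ≤ ∫⁻ _ in t ∩ {s | ρ.rnDeriv μ s ≤ N}, N ∂μ :=
        setLIntegral_mono measurable_const fun s hs => hs.2
    _ = N * μ (t ∩ {s | ρ.rnDeriv μ s ≤ N}) := setLIntegral_const _ _
    _ ≤ N * μ t := by gcongr; exact Set.inter_subset_left

/-- Truncating the marginal densities of a generalized coupling at level `N`. -/
theorem exists_coupling_of_genCoupling [IsProbabilityMeasure μ] [IsProbabilityMeasure ν]
    {ξ : Measure (S × S)} (hξ : ξ ∈ genCouplings μ ν) {N : ℝ≥0∞} (hN : N ≠ 0) (hN' : N ≠ ∞) :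
    ∃ η ∈ couplings μ ν, ∀ s, ξ s ≤ N * η s +
      (ξ.fst {s | N < ξ.fst.rnDeriv μ s} + ξ.snd {s | N < ξ.snd.rnDeriv ν s}) := by
  obtain ⟨hp, h₁, h₂⟩ := hξ
  set A := {s | ξ.fst.rnDeriv μ s ≤ N} with hA
  set B := {s | ξ.snd.rnDeriv ν s ≤ N} with hB
  have mA : MeasurableSet A := measurableSet_le (Measure.measurable_rnDeriv _ _) measurable_const
  have mB : MeasurableSet B := measurableSet_le (Measure.measurable_rnDeriv _ _) measurable_const
  have f₁ : (ξ.restrict (A ×ˢ B)).fst ≤ N • μ := by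
    refine le_trans ?_ (restrict_rnDeriv_le_le_smul h₁ N)
    refine Measure.le_iff.2 fun t ht => ?_
    rw [Measure.fst_apply ht, Measure.restrict_apply (measurable_fst ht),
      Measure.restrict_apply ht, Measure.fst_apply (ht.inter mA)]
    exact measure_mono fun z hz => ⟨hz.1, hz.2.1⟩
  have f₂ : (ξ.restrict (A ×ˢ B)).snd ≤ N • ν := by
    refine le_trans ?_ (restrict_rnDeriv_le_le_smul h₂ N)
    refine Measure.le_iff.2 fun t ht => ?_
    rw [Measure.snd_apply ht, Measure.restrict_apply (measurable_snd ht),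
      Measure.restrict_apply ht, Measure.snd_apply (ht.inter mB)]
    exact measure_mono fun z hz => ⟨hz.1, hz.2.2⟩
  have aux : ∀ {ρ τ : Measure S}, ρ ≤ N • τ → N⁻¹ • ρ ≤ τ := by
    intro ρ τ h
    refine Measure.le_iff'.2 fun t => ?_
    have := Measure.le_iff'.1 h t
    simp only [Measure.smul_apply, smul_eq_mul] at this ⊢
    calc N⁻¹ * ρ t ≤ N⁻¹ * (N * τ t) := by gcongr
      _ = τ t := by rw [← mul_assoc, ENNReal.inv_mul_cancel hN hN', one_mul]
  -- On the rectangle `ξ` is at most `N * η`; what lies outside it is paid for by the two tails.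
  obtain ⟨η, hη, hle⟩ := exists_coupling_ge (ζ := N⁻¹ • ξ.restrict (A ×ˢ B)) (μ := μ) (ν := ν)
    (by rw [Measure.fst, Measure.map_smul]; exact aux f₁)
    (by rw [Measure.snd, Measure.map_smul]; exact aux f₂)
  refine ⟨η, hη, fun s => ?_⟩
  have hAc : {s | N < ξ.fst.rnDeriv μ s} = Aᶜ := by ext; simp [hA]
  have hBc : {s | N < ξ.snd.rnDeriv ν s} = Bᶜ := by ext; simp [hB]
  rw [hAc, hBc, Measure.fst_apply mA.compl, Measure.snd_apply mB.compl]
  have hs : s ⊆ (s ∩ A ×ˢ B) ∪ (Prod.fst ⁻¹' Aᶜ ∪ Prod.snd ⁻¹' Bᶜ) := by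
    intro z hz
    by_cases h1 : z.1 ∈ A <;> by_cases h2 : z.2 ∈ B <;> simp [hz, h1, h2]
  have hle' := Measure.le_iff'.1 hle s
  rw [Measure.smul_apply, Measure.restrict_apply' (mA.prod mB), smul_eq_mul] at hle'
  calc ξ s ≤ ξ (s ∩ A ×ˢ B) + (ξ (Prod.fst ⁻¹' Aᶜ) + ξ (Prod.snd ⁻¹' Bᶜ)) :=
        (measure_mono hs).trans ((measure_union_le _ _).trans
          (by gcongr; exact measure_union_le _ _))
    _ = N * (N⁻¹ * ξ (s ∩ A ×ˢ B)) + (ξ (Prod.fst ⁻¹' Aᶜ) + ξ (Prod.snd ⁻¹' Bᶜ)) := by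
        rw [← mul_assoc, ENNReal.mul_inv_cancel hN hN', one_mul]
    _ ≤ _ := by gcongr

/-- Markov's inequality for the density `g`: where `g > N`, one has `N ^ (p - 1) * g ≤ g ^ p`. The
resulting tail bound depends on `ρ` only through `R`. -/
theorem measure_lt_rnDeriv_mul_le {ρ μ : Measure S} [IsFiniteMeasure ρ] [SigmaFinite μ]
    (h : ρ ≪ μ) {p R : ℝ} (hp : 1 < p)
    (hR : (∫⁻ s, (ρ.rnDeriv μ s) ^ p ∂μ) ^ (1 / p) ≤ ENNReal.ofReal R) (N : ℝ≥0∞) :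
    N ^ (p - 1) * ρ {s | N < ρ.rnDeriv μ s} ≤ ENNReal.ofReal R ^ p := by
  have hA : MeasurableSet {s | N < ρ.rnDeriv μ s} :=
    measurableSet_lt measurable_const (Measure.measurable_rnDeriv ρ μ)
  have hm := Measure.measurable_rnDeriv ρ μ
  rw [← Measure.setLIntegral_rnDeriv h, ← lintegral_const_mul _ hm]
  calc ∫⁻ s in {s | N < ρ.rnDeriv μ s}, N ^ (p - 1) * ρ.rnDeriv μ s ∂μ
      ≤ ∫⁻ s in {s | N < ρ.rnDeriv μ s}, (ρ.rnDeriv μ s) ^ p ∂μ := by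
        refine setLIntegral_mono (hm.pow_const p) fun s hs => ?_
        have hs' : N < ρ.rnDeriv μ s := hs
        calc N ^ (p - 1) * ρ.rnDeriv μ s
            ≤ (ρ.rnDeriv μ s) ^ (p - 1) * (ρ.rnDeriv μ s) ^ (1 : ℝ) := by
              rw [ENNReal.rpow_one]
              gcongr
          _ = (ρ.rnDeriv μ s) ^ p := by
              rw [← ENNReal.rpow_add_of_nonneg _ _ (by linarith) zero_le_one, sub_add_cancel]
    _ ≤ ∫⁻ s, (ρ.rnDeriv μ s) ^ p ∂μ := setLIntegral_le_lintegral _ _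
    _ ≤ _ := by
        rw [one_div] at hR
        have := ENNReal.rpow_le_rpow hR (by linarith : 0 ≤ p)
        rwa [ENNReal.rpow_inv_rpow (by linarith)] at this

end Couplings

/-! ### Comparison of the three coupling conditions. -/

section Chain

theorem closeAt_mono {E : Type*} {d : E → E → ℝ} (n : ℕ) : Monotone fun ε => closeAt d n ε :=
  fun _ _ h _ hω => le_trans hω h

variable {E : Type*} [MeasurableSpace E] {d : E → E → ℝ} {P : Kernel E E} [IsMarkovKernel P]

instance (x : E) : IsProbabilityMeasure (pathLaw P x) := by
  unfold pathLaw
  infer_instance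

theorem limZero_iSup_pos_iff (𝒞 : Set (Measure ((ℕ → E) × (ℕ → E)))) :
    (0 < limZero fun ε => liminf (fun n : ℕ => ⨆ ξ ∈ 𝒞, ξ (closeAt d n ε)) atTop) ↔
      ∃ a, 0 < a ∧ a ≠ ∞ ∧ ∀ ε > 0, ∀ᶠ n in atTop, a ≤ ⨆ ξ ∈ 𝒞, ξ (closeAt d n ε) :=
  limZero_liminf_pos_iff (u := fun ε n => ⨆ ξ ∈ 𝒞, ξ (closeAt d n ε)) fun n _ _ h =>
    iSup₂_mono fun _ _ => measure_mono (closeAt_mono n h)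

variable {x y : E}

theorem CouplingCond.lpCouplingCond (h : CouplingCond d P x y) {p R : ℝ} (hR : 1 ≤ R) :
    LpCouplingCond d P p R x y := by
  rw [CouplingCond, limZero_iSup_pos_iff] at h
  rw [LpCouplingCond, limZero_iSup_pos_iff]
  obtain ⟨a, ha, ha', h⟩ := h
  exact ⟨a, ha, ha', fun ε hε => (h ε hε).mono fun n hn =>
    hn.trans (biSup_mono fun _ hξ => couplings_subset_genCouplingsLp hR hξ)⟩

/-- If a family of generalized couplings satisfies the closeness condition, and at some level `N`
the tails of their marginal densities are small, then true couplings satisfy it too. -/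
theorem couplingCond_of_tails {𝒞 : Set (Measure ((ℕ → E) × (ℕ → E)))}
    (h𝒞 : 𝒞 ⊆ genCouplings (pathLaw P x) (pathLaw P y)) {a : ℝ≥0∞} (ha : 0 < a) (ha' : a ≠ ∞)
    (h : ∀ ε > 0, ∀ᶠ n in atTop, a ≤ ⨆ ξ ∈ 𝒞, ξ (closeAt d n ε))
    {N : ℝ≥0∞} (hN : N ≠ 0) (hN' : N ≠ ∞)
    (h₁ : ∀ ξ ∈ 𝒞, ξ.fst {s | N < ξ.fst.rnDeriv (pathLaw P x) s} ≤ a / 4)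
    (h₂ : ∀ ξ ∈ 𝒞, ξ.snd {s | N < ξ.snd.rnDeriv (pathLaw P y) s} ≤ a / 4) :
    CouplingCond d P x y := by
  rw [CouplingCond, limZero_iSup_pos_iff]
  -- The two tails cost at most `a / 2`, and truncation at level `N` divides the rest by `N`.
  refine ⟨a / 2 / N, ENNReal.div_pos (ENNReal.half_pos ha.ne').ne' hN',
    ENNReal.div_ne_top (ENNReal.div_ne_top ha' two_ne_zero) hN, fun ε hε => ?_⟩
  filter_upwards [h ε hε] with n hn
  have h4 : a / 4 + a / 4 = a / 2 := by
    have : a / 4 = a / 2 / 2 := by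
      rw [div_eq_mul_inv, div_eq_mul_inv, div_eq_mul_inv, mul_assoc,
        ← ENNReal.mul_inv (by simp) (by simp)]
      norm_num
    rw [this, ENNReal.add_halves]
  set K := ⨆ ξ ∈ couplings (pathLaw P x) (pathLaw P y), ξ (closeAt d n ε)
  have hle : a ≤ N * K + a / 2 := by
    refine hn.trans (iSup₂_le fun ξ hξ => ?_)
    obtain ⟨η, hη, hs⟩ := exists_coupling_of_genCoupling (h𝒞 hξ) hN hN'
    refine (hs _).trans (add_le_add ?_ (h4 ▸ add_le_add (h₁ ξ hξ) (h₂ ξ hξ)))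
    gcongr
    exact le_iSup₂ (f := fun (η : Measure _) _ => η (closeAt d n ε)) η hη
  rw [ENNReal.div_le_iff' hN hN']
  have h2 : a / 2 ≠ ∞ := ENNReal.div_ne_top ha' two_ne_zero
  nth_rewrite 1 [← ENNReal.add_halves a] at hle
  exact (ENNReal.add_le_add_iff_right h2).1 hle

theorem LpCouplingCond.couplingCond {p R : ℝ} (hp : 1 < p) (h : LpCouplingCond d P p R x y) :
    CouplingCond d P x y := by
  rw [LpCouplingCond, limZero_iSup_pos_iff] at h
  obtain ⟨a, ha, ha', h⟩ := h
  have ha4 : a / 4 ≠ 0 := (ENNReal.div_pos ha.ne' (by norm_num)).ne'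
  have ha4' : a / 4 ≠ ∞ := ENNReal.div_ne_top ha' (by norm_num)
  -- `T` is the value of `N ^ (p - 1)` that makes the tail bound `R ^ p / T` at most `a / 4`; the
  -- added `1` keeps it nonzero.
  set T : ℝ≥0∞ := ENNReal.ofReal R ^ p / (a / 4) + 1 with hT
  have hT0 : T ≠ 0 := by simp [hT]
  have hTt : T ≠ ∞ := by
    refine ENNReal.add_ne_top.2 ⟨ENNReal.div_ne_top ?_ ha4, ENNReal.one_ne_top⟩
    exact ENNReal.rpow_ne_top_of_nonneg (by linarith) ENNReal.ofReal_ne_top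
  have hp' : 0 < p - 1 := by linarith
  set N : ℝ≥0∞ := T ^ (p - 1)⁻¹ with hNdef
  have hNp : N ^ (p - 1) = T := ENNReal.rpow_inv_rpow hp'.ne' T
  have hN : N ≠ 0 := by
    intro h0
    rw [h0, ENNReal.zero_rpow_of_pos hp'] at hNp
    exact hT0 hNp.symm
  have hN' : N ≠ ∞ := ENNReal.rpow_ne_top_of_nonneg (inv_nonneg.2 hp'.le) hTt
  have tail : ∀ {ρ τ : Measure (ℕ → E)} [IsFiniteMeasure ρ] [SigmaFinite τ], ρ ≪ τ →
      (∫⁻ s, (ρ.rnDeriv τ s) ^ p ∂τ) ^ (1 / p) ≤ ENNReal.ofReal R →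
      ρ {s | N < ρ.rnDeriv τ s} ≤ a / 4 := by
    intro ρ τ _ _ hac hR
    have := measure_lt_rnDeriv_mul_le hac hp hR N
    rw [hNp] at this
    have h1 : ρ {s | N < ρ.rnDeriv τ s} ≤ ENNReal.ofReal R ^ p / T := by
      rwa [ENNReal.le_div_iff_mul_le (Or.inl hT0) (Or.inl hTt), mul_comm]
    refine h1.trans (ENNReal.div_le_of_le_mul ?_)
    rw [hT, mul_add, ENNReal.mul_div_cancel ha4 ha4']
    exact le_self_add
  refine couplingCond_of_tails (fun ξ hξ => hξ.1) ha ha' h hN hN' ?_ ?_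
  · rintro ξ ⟨⟨_, h1, -⟩, h2, -⟩
    exact tail h1 h2
  · rintro ξ ⟨⟨_, -, h1⟩, -, h2⟩
    exact tail h1 h2

/-- The density is finite `μ`-a.e., hence `ρ`-a.e., so its superlevel sets decrease to a `ρ`-null
set. -/
theorem tendsto_measure_lt_rnDeriv {S : Type*} [MeasurableSpace S] {ρ μ : Measure S}
    [IsFiniteMeasure ρ] [SigmaFinite μ] (h : ρ ≪ μ) :
    Tendsto (fun k : ℕ => ρ {s | (k : ℝ≥0∞) < ρ.rnDeriv μ s}) atTop (𝓝 0) := by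
  have hm := Measure.measurable_rnDeriv ρ μ
  have h0 : ρ (⋂ k : ℕ, {s | (k : ℝ≥0∞) < ρ.rnDeriv μ s}) = 0 := by
    have := h.ae_le (Measure.rnDeriv_lt_top ρ μ)
    refine measure_mono_null (fun s hs => ?_) this
    simp only [Set.mem_iInter, Set.mem_ofPred_eq] at hs
    intro hlt
    obtain ⟨k, hk⟩ := ENNReal.exists_nat_gt (ne_of_lt hlt)
    exact (hk.trans (hs k)).false
  rw [← h0]
  refine tendsto_measure_iInter_atTop
    (fun k => (measurableSet_lt measurable_const hm).nullMeasurableSet) ?_ ⟨0, measure_ne_top _ _⟩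
  intro k l hkl s hs
  have hs' : (l : ℝ≥0∞) < ρ.rnDeriv μ s := hs
  exact lt_of_le_of_lt (by exact_mod_cast hkl) hs'

/-- With the supremum outside the limits, one `ξ` serves for all `n` and `ε`, so a single truncation
level suffices without any `L^p` bound. -/
theorem GenCouplingCond.couplingCond (h : GenCouplingCond d P x y) : CouplingCond d P x y := by
  obtain ⟨ξ, hξ⟩ := lt_iSup_iff.1 h
  obtain ⟨hξC, hpos⟩ := lt_iSup_iff.1 hξ
  rw [limZero_liminf_pos_iff (u := fun ε n => ξ (closeAt d n ε))
    fun n _ _ h => measure_mono (closeAt_mono n h)] at hpos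
  obtain ⟨a, ha, ha', h⟩ := hpos
  have ha4 : 0 < a / 4 := ENNReal.div_pos ha.ne' (by norm_num)
  have ⟨hp, h1, h2⟩ := hξC
  obtain ⟨k, hk1, hk2, hk⟩ := ((((tendsto_measure_lt_rnDeriv h1).eventually_lt_const ha4).and
    (((tendsto_measure_lt_rnDeriv h2).eventually_lt_const ha4).and
      (eventually_ge_atTop 1))).exists)
  refine couplingCond_of_tails (𝒞 := {ξ}) (by simpa using hξC) ha ha' (by simpa using h)
    (N := k) (by simpa using by omega) (ENNReal.natCast_ne_top k) ?_ ?_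
  · rintro _ rfl
    exact hk1.le
  · rintro _ rfl
    exact hk2.le

end Chain

/-! ### The `n`-step kernels as time marginals of the path law. -/

section NStep

variable {E : Type*} [MeasurableSpace E] {P : Kernel E E}

instance [IsMarkovKernel P] (n : ℕ) : IsMarkovKernel (nStep P n) := by
  induction n with
  | zero => exact inferInstanceAs (IsMarkovKernel Kernel.id)
  | succ n ih => exact inferInstanceAs (IsMarkovKernel (P ∘ₖ nStep P n))

theorem nStep_add (m n : ℕ) : nStep P (m + n) = nStep P m ∘ₖ nStep P n := by
  induction m with
  | zero => rw [Nat.zero_add]; exact (Kernel.id_comp _).symm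
  | succ m ih =>
    rw [Nat.add_right_comm]
    change P ∘ₖ nStep P (m + n) = (P ∘ₖ nStep P m) ∘ₖ nStep P n
    rw [ih, Kernel.comp_assoc]

theorem nStep_one : nStep P 1 = P := Kernel.comp_id P

theorem invariant_nStep {μ : Measure E} (h : P.Invariant μ) (n : ℕ) :
    (nStep P n).Invariant μ := by
  induction n with
  | zero => exact Measure.id_comp
  | succ n ih => exact h.comp ih

theorem map_eval_pathLaw [IsMarkovKernel P] (x : E) (n : ℕ) :
    (pathLaw P x).map (fun ω => ω n) = nStep P n x := by
  induction n with
  | zero =>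
    change _ = Kernel.id x
    have h0 : (pathLaw P x).map (Preorder.frestrictLe 0) =
        (Measure.dirac x).map (MeasurableEquiv.piUnique (fun _ : Finset.Iic 0 => E)).symm := by
      rw [pathLaw, Kernel.trajMeasure, Measure.map_comp _ _ (by fun_prop),
        Kernel.traj_map_frestrictLe, Kernel.partialTraj_self]
      exact Measure.id_comp
    have h1 : (fun ω : ℕ → E => ω 0) =
        (fun h : Finset.Iic 0 → E => h ⟨0, Finset.mem_Iic.2 le_rfl⟩) ∘ Preorder.frestrictLe 0 := rfl
    rw [h1, ← Measure.map_map (by fun_prop) (by fun_prop), h0,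
      Measure.map_map (by fun_prop) (by fun_prop),
      Measure.map_dirac' ((measurable_pi_apply _).comp (MeasurableEquiv.measurable _)) x,
      Kernel.id_apply]
    rfl
  | succ n ih =>
    -- This is the joint law of the past and the next coordinate. Its second marginal gives the
    -- recursion, since the kernel sees only the last coordinate of the past.
    have h := Kernel.map_frestrictLe_trajMeasure_compProd_eq_map_trajMeasure
      (X := fun _ => E) (μ₀ := Measure.dirac x)
      (κ := fun n => P.comap (fun h : (i : Finset.Iic n) → E => h ⟨n, Finset.mem_Iic.2 le_rfl⟩)
        (measurable_pi_apply _)) (a := n)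
    have h2 := congrArg Measure.snd h
    rw [Measure.snd_compProd, Measure.snd, Measure.map_map (by fun_prop) (by fun_prop),
      ← Kernel.comp_deterministic_eq_comap, ← Measure.comp_assoc,
      Measure.deterministic_comp_eq_map, Measure.map_map (by fun_prop) (by fun_prop)] at h2
    change P ∘ₘ ((pathLaw P x).map (fun ω => ω n)) = (pathLaw P x).map (fun ω => ω (n + 1)) at h2
    rw [← h2, ih]
    change _ = (P ∘ₖ nStep P n) x
    rw [Kernel.comp_apply]

end NStep

/-! ### Variance estimates for bounded functions. -/

section Bounded

variable {E : Type*} [MeasurableSpace E]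

theorem integrable_of_abs_le {f : E → ℝ} (hf : Measurable f) {C : ℝ} (hC : ∀ x, |f x| ≤ C)
    (κ : Measure E) [IsFiniteMeasure κ] : Integrable f κ :=
  Integrable.of_bound hf.aestronglyMeasurable C (Eventually.of_forall hC)

theorem abs_integral_le {f : E → ℝ} {C : ℝ} (hC : ∀ x, |f x| ≤ C)
    (κ : Measure E) [IsProbabilityMeasure κ] : |∫ x, f x ∂κ| ≤ C := by
  simpa using norm_integral_le_of_norm_le_const (μ := κ) (f := f) (Eventually.of_forall hC)

theorem sq_le_of_abs_le {a C : ℝ} (h : |a| ≤ C) : |a ^ 2| ≤ C ^ 2 := by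
  rw [abs_pow]
  exact pow_le_pow_left₀ (abs_nonneg _) h 2

theorem integral_sub_sq {f : E → ℝ} (hf : Measurable f) {C : ℝ} (hC : ∀ x, |f x| ≤ C)
    (κ : Measure E) [IsProbabilityMeasure κ] (c : ℝ) :
    ∫ x, (f x - c) ^ 2 ∂κ = ∫ x, f x ^ 2 ∂κ - 2 * c * ∫ x, f x ∂κ + c ^ 2 := by
  have i1 := integrable_of_abs_le hf hC κ
  have i2 := integrable_of_abs_le (hf.pow_const 2) (fun x => sq_le_of_abs_le (hC x)) κ
  have : (fun x => (f x - c) ^ 2) = fun x => (f x ^ 2 - 2 * c * f x) + c ^ 2 := by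
    ext x; ring
  have i3 : Integrable (fun x => f x ^ 2 - 2 * c * f x) κ := i2.sub (i1.const_mul _)
  rw [this, integral_add i3 (integrable_const _), integral_sub i2 (i1.const_mul _),
    integral_const_mul]
  simp

theorem integral_sub_integral_sq {f : E → ℝ} (hf : Measurable f) {C : ℝ} (hC : ∀ x, |f x| ≤ C)
    (κ : Measure E) [IsProbabilityMeasure κ] :
    ∫ x, (f x - ∫ y, f y ∂κ) ^ 2 ∂κ = ∫ x, f x ^ 2 ∂κ - (∫ x, f x ∂κ) ^ 2 := by
  rw [integral_sub_sq hf hC]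
  ring

/-- Jensen's inequality: the right side exceeds the left by the variance of `f`. -/
theorem sq_sub_integral_le {f : E → ℝ} (hf : Measurable f) {C : ℝ} (hC : ∀ x, |f x| ≤ C)
    (κ : Measure E) [IsProbabilityMeasure κ] (c : ℝ) :
    (c - ∫ x, f x ∂κ) ^ 2 ≤ ∫ x, (c - f x) ^ 2 ∂κ := by
  have h1 := integral_sub_integral_sq hf hC κ
  have h2 : 0 ≤ ∫ x, (f x - ∫ y, f y ∂κ) ^ 2 ∂κ := integral_nonneg fun x => sq_nonneg _
  have h3 := integral_sub_sq hf hC κ c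
  have h4 : ∫ x, (c - f x) ^ 2 ∂κ = ∫ x, (f x - c) ^ 2 ∂κ := by
    congr 1; ext x; ring
  nlinarith

/-- If `f` is nearly constant under both marginals of a coupling that puts mass `a` on pairs that
are `ε`-close, then the two means of `f` are close. -/
theorem mul_sq_sub_integral_le {d : E → E → ℝ} (hd : Measurable fun z : E × E => d z.1 z.2)
    {f : E → ℝ} (hf : Measurable f) {C : ℝ} (hC : ∀ x, |f x| ≤ C) {κ₁ κ₂ : Measure E}
    {ξ : Measure (E × E)} (hξ : ξ ∈ couplings κ₁ κ₂) {A : Set E} (hA : MeasurableSet A)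
    {ε δ a : ℝ} (hAε : ∀ u ∈ A, ∀ v, d u v ≤ ε → |f u - f v| ≤ δ)
    (ha : a ≤ ξ.real {z | d z.1 z.2 ≤ ε}) :
    a * (∫ x, f x ∂κ₁ - ∫ x, f x ∂κ₂) ^ 2 ≤
      3 * (∫ u, (f u - ∫ x, f x ∂κ₁) ^ 2 ∂κ₁ + ∫ v, (f v - ∫ x, f x ∂κ₂) ^ 2 ∂κ₂ + δ ^ 2 +
        (2 * C) ^ 2 * κ₁.real Aᶜ) := by
  obtain ⟨hp, rfl, rfl⟩ := hξ
  set c₁ := ∫ x, f x ∂ξ.fst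
  set c₂ := ∫ x, f x ∂ξ.snd
  have hc₁ : |c₁| ≤ C := abs_integral_le hC _
  have hc₂ : |c₂| ≤ C := abs_integral_le hC _
  have hset : MeasurableSet {z : E × E | d z.1 z.2 ≤ ε} := measurableSet_le hd measurable_const
  have bd : ∀ c, |c| ≤ C → ∀ x, |(f x - c) ^ 2| ≤ (C + C) ^ 2 := fun c hc x =>
    sq_le_of_abs_le ((abs_sub _ _).trans (add_le_add (hC x) hc))
  have i₁ : Integrable (fun z : E × E => (f z.1 - c₁) ^ 2) ξ :=
    integrable_of_abs_le (by fun_prop) (fun z => bd c₁ hc₁ z.1) ξ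
  have i₂ : Integrable (fun z : E × E => (f z.2 - c₂) ^ 2) ξ :=
    integrable_of_abs_le (by fun_prop) (fun z => bd c₂ hc₂ z.2) ξ
  have i₃ : Integrable (fun z : E × E => (Prod.fst ⁻¹' Aᶜ).indicator (fun _ => (2 * C) ^ 2) z) ξ :=
    (integrable_const _).indicator (measurable_fst hA.compl)
  have e₁ : ∫ u, (f u - c₁) ^ 2 ∂ξ.fst = ∫ z, (f z.1 - c₁) ^ 2 ∂ξ :=
    integral_map measurable_fst.aemeasurable (by fun_prop)
  have e₂ : ∫ u, (f u - c₂) ^ 2 ∂ξ.snd = ∫ z, (f z.2 - c₂) ^ 2 ∂ξ :=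
    integral_map measurable_snd.aemeasurable (by fun_prop)
  have e₃ : (2 * C) ^ 2 * ξ.fst.real Aᶜ =
      ∫ z, (Prod.fst ⁻¹' Aᶜ).indicator (fun _ => (2 * C) ^ 2) z ∂ξ := by
    rw [integral_indicator (measurable_fst hA.compl), setIntegral_const, smul_eq_mul, mul_comm,
      measureReal_def, measureReal_def, Measure.fst_apply hA.compl]
  have hl : ξ.real {z | d z.1 z.2 ≤ ε} * (c₁ - c₂) ^ 2 =
      ∫ z, {z : E × E | d z.1 z.2 ≤ ε}.indicator (fun _ => (c₁ - c₂) ^ 2) z ∂ξ := by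
    rw [integral_indicator hset, setIntegral_const, smul_eq_mul]
  have e₄ : δ ^ 2 = ∫ _, δ ^ 2 ∂ξ := by simp
  refine (mul_le_mul_of_nonneg_right ha (sq_nonneg _)).trans ?_
  have i₄ : Integrable (fun z : E × E => (f z.1 - c₁) ^ 2 + (f z.2 - c₂) ^ 2) ξ := i₁.add i₂
  have i₅ : Integrable (fun z : E × E => (f z.1 - c₁) ^ 2 + (f z.2 - c₂) ^ 2 + δ ^ 2) ξ :=
    i₄.add (integrable_const _)
  rw [hl, e₁, e₂, e₃, e₄, ← integral_add i₁ i₂, ← integral_add i₄ (integrable_const _),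
    ← integral_add i₅ i₃, ← integral_const_mul]
  refine integral_mono ((integrable_const _).indicator hset) ((i₅.add i₃).const_mul 3) fun z => ?_
  beta_reduce
  -- Pointwise at `z = (u, v)`, split `c₁ - c₂` into `c₁ - f u`, `f v - c₂` and `f u - f v`. On
  -- close pairs the last term is at most `δ` if `u ∈ A` and at most `2 * C` otherwise; off them the
  -- left side is zero.
  have key : ∀ p q r : ℝ, (p + q + r) ^ 2 ≤ 3 * (p ^ 2 + q ^ 2 + r ^ 2) := fun p q r => by
    nlinarith [sq_nonneg (p - q), sq_nonneg (q - r), sq_nonneg (p - r)]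
  have hk := key (c₁ - f z.1) (f z.2 - c₂) (f z.1 - f z.2)
  have h1 : c₁ - f z.1 + (f z.2 - c₂) + (f z.1 - f z.2) = c₁ - c₂ := by ring
  have h2 : (c₁ - f z.1) ^ 2 = (f z.1 - c₁) ^ 2 := by ring
  rw [h1, h2] at hk
  have hn₁ := sq_nonneg (f z.1 - c₁)
  have hn₂ := sq_nonneg (f z.2 - c₂)
  by_cases hz : d z.1 z.2 ≤ ε
  · rw [Set.indicator_of_mem (show z ∈ {z : E × E | d z.1 z.2 ≤ ε} from hz)]
    by_cases hzA : z.1 ∈ A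
    · rw [Set.indicator_of_notMem (by simpa using hzA)]
      have := sq_le_of_abs_le (hAε _ hzA _ hz)
      rw [abs_of_nonneg (sq_nonneg _)] at this
      linarith
    · rw [Set.indicator_of_mem (by simpa using hzA)]
      have : |f z.1 - f z.2| ≤ 2 * C := by
        have := (abs_sub (f z.1) (f z.2)).trans (add_le_add (hC z.1) (hC z.2))
        linarith
      have := sq_le_of_abs_le this
      rw [abs_of_nonneg (sq_nonneg _)] at this
      nlinarith [sq_nonneg δ]
  · rw [Set.indicator_of_notMem (show z ∉ {z : E × E | d z.1 z.2 ≤ ε} from hz)]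
    have : 0 ≤ (Prod.fst ⁻¹' Aᶜ).indicator (fun _ : E × E => (2 * C) ^ 2) z :=
      Set.indicator_nonneg (fun _ _ => sq_nonneg _) z
    nlinarith [sq_nonneg δ]

end Bounded

/-! ### Convergence of integrals under bounds with a pointwise constant. -/

/-- The sets `G j` where the constant `j` works exhaust `Ω` up to a null set. First `j` is fixed so
that the complement contributes little, then `m` so that `j * r m` is small, and finally `n`, by
dominated convergence for the excess of `D` over its bound on `G j`. Since `j` multiplies `r m`, it
must be chosen before `m`. -/
theorem tendsto_lintegral_zero_of_eventually_le_mul {Ω : Type*} [MeasurableSpace Ω]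
    {ρ : Measure Ω} [IsFiniteMeasure ρ] {D : ℕ → Ω → ℝ≥0∞} (hD : ∀ n, Measurable (D n))
    {B : ℝ≥0∞} (hB : B ≠ ∞) (hDB : ∀ n ω, D n ω ≤ B) {R : ℕ → ℕ → Ω → ℝ≥0∞}
    (hR : ∀ m n, Measurable (R m n)) {r : ℕ → ℝ≥0∞} (hr : Tendsto r atTop (𝓝 0))
    (hRr : ∀ m n, ∫⁻ ω, R m n ω ∂ρ ≤ r m)
    (h : ∀ᵐ ω ∂ρ, ∃ j : ℕ, ∀ m, ∀ᶠ n in atTop, D (n + m) ω ≤ j * R m n ω) :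
    Tendsto (fun n => ∫⁻ ω, D n ω ∂ρ) atTop (𝓝 0) := by
  set G : ℕ → Set Ω := fun j => {ω | ∀ m, ∀ᶠ n in atTop, D (n + m) ω ≤ j * R m n ω} with hG
  have hGm : ∀ j, MeasurableSet (G j) := by
    intro j
    have : G j = ⋂ m, ⋃ n₀, ⋂ n ≥ n₀, {ω | D (n + m) ω ≤ j * R m n ω} := by
      ext ω
      simp [hG, eventually_atTop]
    rw [this]
    refine MeasurableSet.iInter fun m => MeasurableSet.iUnion fun n₀ =>
      MeasurableSet.iInter fun n => MeasurableSet.iInter fun _ =>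
        measurableSet_le (hD _) ((hR m n).const_mul _)
  have hGmono : Monotone G := fun i j hij ω hω m => (hω m).mono fun n hn => hn.trans (by gcongr)
  have hG0 : Tendsto (fun j => ρ (G j)ᶜ) atTop (𝓝 0) := by
    have h0 : ρ (⋂ j, (G j)ᶜ) = 0 := by
      refine measure_mono_null (fun ω hω => ?_) h
      rintro ⟨j, hj⟩
      exact Set.mem_iInter.1 hω j hj
    rw [← h0]
    exact tendsto_measure_iInter_atTop (fun j => (hGm j).compl.nullMeasurableSet)
      (fun i j hij => Set.compl_subset_compl.2 (hGmono hij)) ⟨0, measure_ne_top _ _⟩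
  refine ENNReal.tendsto_nhds_zero.2 fun e he => ?_
  have he3 : 0 < e / 3 := ENNReal.div_pos he.ne' (by norm_num)
  have t1 : Tendsto (fun j => B * ρ (G j)ᶜ) atTop (𝓝 0) := by
    simpa using ENNReal.Tendsto.const_mul hG0 (Or.inr hB)
  obtain ⟨j, hj⟩ := (t1.eventually_le_const he3).exists
  have t2 : Tendsto (fun m => (j : ℝ≥0∞) * r m) atTop (𝓝 0) := by
    simpa using ENNReal.Tendsto.const_mul hr (Or.inr (ENNReal.natCast_ne_top j))
  obtain ⟨m, hm⟩ := (t2.eventually_le_const he3).exists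
  -- Truncated subtraction makes `H` the positive part of the excess: it is bounded by `B` and
  -- eventually zero at each point.
  set H : ℕ → Ω → ℝ≥0∞ := fun n => (G j).indicator fun ω => D (n + m) ω - j * R m n ω with hH
  have t3 : Tendsto (fun n => ∫⁻ ω, H n ω ∂ρ) atTop (𝓝 0) := by
    have := tendsto_lintegral_of_dominated_convergence (μ := ρ) (F := H) (f := fun _ => 0)
      (fun _ => B) (fun n => ((hD _).sub ((hR m n).const_mul _)).indicator (hGm j))
      (fun n => Eventually.of_forall fun ω => ?_) ?_ (Eventually.of_forall fun ω => ?_)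
    · simpa using this
    · refine (Set.indicator_le_self _ _ ω).trans (tsub_le_self.trans (hDB _ _))
    · simpa using ENNReal.mul_ne_top hB (measure_ne_top _ _)
    · refine tendsto_const_nhds.congr' ?_
      by_cases hω : ω ∈ G j
      · filter_upwards [hω m] with n hn
        simp [hH, hω, tsub_eq_zero_of_le hn]
      · simp [hH, hω]
  have t4 : ∀ᶠ n in atTop, ∫⁻ ω, D (n + m) ω ∂ρ ≤ e := by
    filter_upwards [t3.eventually_le_const he3] with n hn
    calc ∫⁻ ω, D (n + m) ω ∂ρ
        ≤ ∫⁻ ω, ((H n ω + j * R m n ω) + (G j)ᶜ.indicator (fun _ => B) ω) ∂ρ := by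
          refine lintegral_mono fun ω => ?_
          by_cases hω : ω ∈ G j
          · simp only [hH, Set.indicator_of_mem hω]
            exact le_add_right le_tsub_add
          · rw [Set.indicator_of_mem (by simpa using hω)]
            exact le_add_left (hDB _ _)
      _ = (∫⁻ ω, H n ω ∂ρ + j * ∫⁻ ω, R m n ω ∂ρ) + B * ρ (G j)ᶜ := by
          rw [lintegral_add_right _ (measurable_const.indicator (hGm j).compl),
            lintegral_add_right _ ((hR m n).const_mul _), lintegral_const_mul _ (hR m n),
            lintegral_indicator_const (hGm j).compl]
      _ ≤ (e / 3 + e / 3) + e / 3 := by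
          gcongr
          exact (mul_le_mul_right (hRr m n) _).trans hm
      _ = e := ENNReal.add_thirds e
  rw [eventually_atTop] at t4 ⊢
  obtain ⟨n₀, hn₀⟩ := t4
  refine ⟨n₀ + m, fun n hn => ?_⟩
  have := hn₀ (n - m) (by omega)
  rwa [Nat.sub_add_cancel (by omega)] at this

/-! ### Functions continuous for `d`, seen from the given topology. -/

section Metric

variable {E : Type*} {d : E → E → ℝ}

theorem IsMetric.nonneg (hd : IsMetric d) (x y : E) : 0 ≤ d x y := by
  have h1 := hd.triangle x y x
  rw [(hd.eq_zero_iff x x).2 rfl, hd.symm y x] at h1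
  linarith

theorem IsMetric.self (hd : IsMetric d) (x : E) : d x x = 0 := (hd.eq_zero_iff x x).2 rfl

variable [TopologicalSpace E]

/-- Continuity of `d` makes every `d`-ball a neighbourhood of its centre. This is what makes
`d`-continuous functions Borel measurable. -/
theorem DContinuous.continuous (hd : IsMetric d)
    (hd_cont : Continuous fun z : E × E => d z.1 z.2) {f : E → ℝ} (hf : DContinuous d f) :
    Continuous f := by
  refine Metric.continuous_iff'.2 fun x ε hε => ?_
  obtain ⟨δ, hδ, h⟩ := hf x ε hε
  have hc : Continuous fun y => d x y := hd_cont.comp (Continuous.prodMk_right x)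
  have : ∀ᶠ y in 𝓝 x, d x y < δ :=
    hc.continuousAt.eventually_lt continuousAt_const (by simpa [hd.self] using hδ)
  exact this.mono fun y hy => by simpa [Real.dist_eq] using h y hy

/-- A `d`-continuous function is uniformly `d`-continuous off a set of small measure. -/
theorem DContinuous.exists_uniform [MeasurableSpace E] [BorelSpace E]
    (hd : IsMetric d) (hd_cont : Continuous fun z : E × E => d z.1 z.2) {f : E → ℝ}
    (hf : DContinuous d f) (μ : Measure E) [IsFiniteMeasure μ] {δ θ : ℝ} (hδ : 0 < δ)
    (hθ : 0 < θ) :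
    ∃ ε > 0, ∃ A : Set E, MeasurableSet A ∧ μ.real Aᶜ ≤ θ ∧
      ∀ u ∈ A, ∀ v, d u v ≤ ε → |f u - f v| ≤ δ := by
  have hfc := hf.continuous hd hd_cont
  -- The bad set at scale `1 / (k + 1)`. As a union of open sets over `v` it is measurable, although
  -- the union may be uncountable; `d`-continuity makes every point leave it eventually.
  set U : ℕ → Set E := fun k => {u | ∃ v, d u v < 1 / ((k : ℝ) + 1) ∧ δ < |f u - f v|} with hU
  have hUo : ∀ k, IsOpen (U k) := by
    intro k
    have : U k = ⋃ v, {u | d u v < 1 / ((k : ℝ) + 1)} ∩ {u | δ < |f u - f v|} := by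
      ext u; simp [hU]
    rw [this]
    refine isOpen_iUnion fun v => IsOpen.inter ?_ ?_
    · exact isOpen_lt (hd_cont.comp (Continuous.prodMk_left v)) continuous_const
    · exact isOpen_lt continuous_const (by fun_prop)
  have hanti : Antitone U := by
    rintro k l hkl u ⟨v, h1, h2⟩
    refine ⟨v, h1.trans_le ?_, h2⟩
    gcongr
  have hinter : ⋂ k, U k = ∅ := by
    refine Set.eq_empty_of_forall_notMem fun u hu => ?_
    obtain ⟨η, hη, h⟩ := hf u δ hδ
    obtain ⟨k, hk⟩ := exists_nat_one_div_lt hη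
    obtain ⟨v, h1, h2⟩ := Set.mem_iInter.1 hu k
    have := h v (h1.trans hk)
    rw [abs_sub_comm] at this
    linarith
  have ht : Tendsto (fun k => μ (U k)) atTop (𝓝 0) := by
    have := tendsto_measure_iInter_atTop (μ := μ) (s := U)
      (fun k => (hUo k).measurableSet.nullMeasurableSet) hanti ⟨0, measure_ne_top _ _⟩
    rwa [hinter, measure_empty] at this
  obtain ⟨k, hk⟩ := (ht.eventually_le_const (ENNReal.ofReal_pos.2 hθ)).exists
  refine ⟨1 / ((k : ℝ) + 1) / 2, by positivity, (U k)ᶜ, (hUo k).measurableSet.compl, ?_, ?_⟩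
  · rw [compl_compl, measureReal_def]
    exact ENNReal.toReal_le_of_le_ofReal hθ.le hk
  · intro u hu v huv
    by_contra hlt
    have hpos : 0 < 1 / ((k : ℝ) + 1) := by positivity
    exact hu ⟨v, by linarith, not_le.1 hlt⟩

end Metric

/-! ### The semigroup acting on bounded functions. -/

section Semigroup

variable {E : Type*} [MeasurableSpace E] {P : Kernel E E} [IsMarkovKernel P]

theorem measurable_integral_nStep (P : Kernel E E) [IsMarkovKernel P] {f : E → ℝ}
    (hf : Measurable f) (n : ℕ) : Measurable fun x => ∫ y, f y ∂(nStep P n x) :=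
  (hf.stronglyMeasurable.integral_kernel (κ := nStep P n)).measurable

theorem integral_nStep_add {f : E → ℝ} (hf : Measurable f) {C : ℝ} (hC : ∀ x, |f x| ≤ C)
    (m n : ℕ) (x : E) :
    ∫ z, f z ∂(nStep P (m + n) x) = ∫ y, (∫ z, f z ∂(nStep P m y)) ∂(nStep P n x) := by
  rw [nStep_add, Kernel.integral_comp]
  exact integrable_of_abs_le hf hC _

theorem integral_integral_nStep {μ : Measure E} [IsProbabilityMeasure μ] (hμ : P.Invariant μ)
    {f : E → ℝ} (hf : Measurable f) {C : ℝ} (hC : ∀ x, |f x| ≤ C) (n : ℕ) :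
    ∫ x, (∫ y, f y ∂(nStep P n x)) ∂μ = ∫ y, f y ∂μ := by
  have h : (nStep P n ∘ₖ Kernel.const Unit μ) () = μ := by
    rw [Kernel.comp_apply, Kernel.const_apply]
    exact invariant_nStep hμ n
  have h2 := Kernel.integral_comp (κ := Kernel.const Unit μ) (η := nStep P n) (a := ())
    (integrable_of_abs_le hf hC _)
  rw [h] at h2
  exact h2.symm

theorem IsDFeller.nStep {d : E → E → ℝ} (h : IsDFeller d P) {f : E → ℝ} (hfm : Measurable f)
    {C : ℝ} (hC : ∀ x, |f x| ≤ C) (hf : DContinuous d f) (n : ℕ) :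
    DContinuous d fun x => ∫ y, f y ∂(nStep P n x) := by
  induction n with
  | zero =>
    convert hf using 2 with x
    change ∫ y, f y ∂(Kernel.id x) = f x
    rw [Kernel.id_apply, integral_dirac' _ _ hfm.stronglyMeasurable]
  | succ n ih =>
    have := h _ ⟨C, fun x => abs_integral_le hC _⟩ ih
    convert this using 2 with x
    -- The extra step is split off at the start of the chain, so that the one-step Feller property
    -- applies to `P_n f`.
    rw [integral_nStep_add hfm hC n 1, nStep_one]

/-- The mean conditional variance of `P_m f` under `P_n` is the loss of `L²` norm between the
times `m` and `m + n`. -/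
theorem integral_condVar_nStep {μ : Measure E} [IsProbabilityMeasure μ] (hμ : P.Invariant μ)
    {f : E → ℝ} (hf : Measurable f) {C : ℝ} (hC : ∀ x, |f x| ≤ C) (m n : ℕ) :
    ∫ x, (∫ u, (∫ z, f z ∂(nStep P m u) - ∫ z, f z ∂(nStep P (m + n) x)) ^ 2 ∂(nStep P n x)) ∂μ =
      ∫ x, (∫ z, f z ∂(nStep P m x)) ^ 2 ∂μ - ∫ x, (∫ z, f z ∂(nStep P (m + n) x)) ^ 2 ∂μ := by
  have hg := measurable_integral_nStep P hf m
  have hgC : ∀ x, |∫ z, f z ∂(nStep P m x)| ≤ C := fun x => abs_integral_le hC _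
  have hg2C : ∀ x, |(∫ z, f z ∂(nStep P m x)) ^ 2| ≤ C ^ 2 := fun x => sq_le_of_abs_le (hgC x)
  have e : ∀ x, ∫ u, (∫ z, f z ∂(nStep P m u) - ∫ z, f z ∂(nStep P (m + n) x)) ^ 2 ∂(nStep P n x)
      = ∫ u, (∫ z, f z ∂(nStep P m u)) ^ 2 ∂(nStep P n x)
        - (∫ z, f z ∂(nStep P (m + n) x)) ^ 2 := by
    intro x
    rw [integral_nStep_add hf hC m n x]
    exact integral_sub_integral_sq hg hgC _
  simp_rw [e]
  rw [integral_sub, integral_integral_nStep hμ (hg.pow_const 2) hg2C]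
  · exact integrable_of_abs_le (measurable_integral_nStep P (hg.pow_const 2) n)
      (fun x => abs_integral_le hg2C _) _
  · exact integrable_of_abs_le ((measurable_integral_nStep P hf (m + n)).pow_const 2)
      (fun x => sq_le_of_abs_le (abs_integral_le hC _)) _

end Semigroup

/-! ### Convergence of `P_n f` in `L²(μ)`. -/

section Ergodic

variable {E : Type*} [MeasurableSpace E] {P : Kernel E E} [IsMarkovKernel P]

theorem CouplingCond.exists_coupling_nStep {d : E → E → ℝ}
    (hd : Measurable fun z : E × E => d z.1 z.2) {x y : E} (h : CouplingCond d P x y) :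
    ∃ a : ℝ, 0 < a ∧ ∀ ε > 0, ∀ᶠ n in atTop, ∃ ξ ∈ couplings (nStep P n x) (nStep P n y),
      a ≤ ξ.real {z | d z.1 z.2 ≤ ε} := by
  rw [CouplingCond, limZero_iSup_pos_iff] at h
  obtain ⟨a, ha, ha', h⟩ := h
  -- Halving gives the strict inequality that selects an actual coupling from the supremum.
  have h2 : a / 2 < a := ENNReal.half_lt_self ha.ne' ha'
  refine ⟨(a / 2).toReal, ENNReal.toReal_pos (ENNReal.half_pos ha.ne').ne' h2.ne_top,
    fun ε hε => (h ε hε).mono fun n hn => ?_⟩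
  obtain ⟨ξ, hξ⟩ := lt_iSup_iff.1 (h2.trans_le hn)
  obtain ⟨⟨hp, h₁, h₂⟩, hlt⟩ := lt_iSup_iff.1 hξ
  have mm : Measurable fun ω : (ℕ → E) × (ℕ → E) => (ω.1 n, ω.2 n) := by fun_prop
  have hp' : IsProbabilityMeasure (ξ.map fun ω => (ω.1 n, ω.2 n)) :=
    Measure.isProbabilityMeasure_map mm.aemeasurable
  refine ⟨ξ.map fun ω => (ω.1 n, ω.2 n), ⟨hp', ?_, ?_⟩, ?_⟩
  · rw [← map_eval_pathLaw, ← h₁, Measure.fst, Measure.fst, Measure.map_map measurable_fst mm,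
      Measure.map_map (by fun_prop) measurable_fst]
    rfl
  · rw [← map_eval_pathLaw, ← h₂, Measure.snd, Measure.snd, Measure.map_map measurable_snd mm,
      Measure.map_map (by fun_prop) measurable_snd]
    rfl
  · rw [measureReal_def, Measure.map_apply mm (measurableSet_le hd measurable_const)]
    exact ENNReal.toReal_mono (measure_ne_top _ _) hlt.le

variable [TopologicalSpace E] [SecondCountableTopology E] [BorelSpace E]

theorem tendsto_lintegral_sq_sub_nStep {d : E → E → ℝ} (hd : IsMetric d)
    (hd_cont : Continuous fun z : E × E => d z.1 z.2) (hP : IsDFeller d P)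
    {μ : Measure E} [IsProbabilityMeasure μ] (hμ : P.Invariant μ)
    (h : ∀ᵐ z ∂(μ.prod μ), CouplingCond d P z.1 z.2) {f : E → ℝ} {C : ℝ} (hC : ∀ x, |f x| ≤ C)
    (hf : DContinuous d f) :
    Tendsto (fun n => ∫⁻ z, ENNReal.ofReal
      ((∫ u, f u ∂(nStep P n z.1) - ∫ u, f u ∂(nStep P n z.2)) ^ 2) ∂(μ.prod μ)) atTop (𝓝 0) := by
  have hfm : Measurable f := (hf.continuous hd hd_cont).measurable
  have hgm : ∀ m, Measurable fun x => ∫ u, f u ∂(nStep P m x) := measurable_integral_nStep P hfm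
  have hgC : ∀ m x, |∫ u, f u ∂(nStep P m x)| ≤ C := fun m x => abs_integral_le hC _
  have hδ : ∀ m : ℕ, 0 < 1 / ((m : ℝ) + 1) := fun m => by positivity
  -- For each `m`, `P_m f` oscillates by at most `1 / (m + 1)` at scale `ε m` around points of `A
  -- m`, whose complement has `μ`-measure at most `1 / (m + 1)`.
  choose ε hε A hA hAμ hAd using fun m : ℕ =>
    (hP.nStep hfm hC hf m).exists_uniform hd hd_cont μ (hδ m) (hδ m)
  set V : ℕ → ℕ → E → ℝ := fun m n x =>
    ∫ u, (∫ z, f z ∂(nStep P m u) - ∫ z, f z ∂(nStep P (m + n) x)) ^ 2 ∂(nStep P n x) with hV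
  have hV0 : ∀ m n x, 0 ≤ V m n x := fun m n x => integral_nonneg fun u => sq_nonneg _
  have hVeq : ∀ m n x, V m n x = ∫ u, (∫ z, f z ∂(nStep P m u)) ^ 2 ∂(nStep P n x)
      - (∫ z, f z ∂(nStep P (m + n) x)) ^ 2 := by
    intro m n x
    simp only [hV]
    rw [integral_nStep_add hfm hC m n x]
    exact integral_sub_integral_sq (hgm m) (hgC m) _
  have hVm : ∀ m n, Measurable (V m n) := by
    intro m n
    have : V m n = fun x => ∫ u, (∫ z, f z ∂(nStep P m u)) ^ 2 ∂(nStep P n x)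
      - (∫ z, f z ∂(nStep P (m + n) x)) ^ 2 := funext (hVeq m n)
    rw [this]
    exact (measurable_integral_nStep P ((hgm m).pow_const 2) n).sub ((hgm (m + n)).pow_const 2)
  have hVC : ∀ m n x, |V m n x| ≤ (C + C) ^ 2 := fun m n x => abs_integral_le (fun u =>
    sq_le_of_abs_le ((abs_sub _ _).trans (add_le_add (hgC m u) (hgC (m + n) x)))) _
  have hVi : ∀ m n, Integrable (V m n) μ := fun m n => integrable_of_abs_le (hVm m n) (hVC m n) μ
  set v : ℕ → ℝ := fun m => ∫ x, (∫ z, f z ∂(nStep P m x)) ^ 2 ∂μ with hv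
  have hVv : ∀ m n, ∫ x, V m n x ∂μ = v m - v (m + n) :=
    fun m n => integral_condVar_nStep hμ hfm hC m n
  have hv0 : ∀ m, 0 ≤ v m := fun m => integral_nonneg fun x => sq_nonneg _
  have hvanti : Antitone v := antitone_nat_of_succ_le fun m => by
    have h1 := hVv m 1
    have h2 : 0 ≤ ∫ x, V m 1 x ∂μ := integral_nonneg (hV0 m 1)
    linarith
  have hbdd : BddBelow (Set.range v) := ⟨0, by rintro _ ⟨m, rfl⟩; exact hv0 m⟩
  have hvt : Tendsto v atTop (𝓝 (⨅ m, v m)) := tendsto_atTop_ciInf hvanti hbdd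
  set L := ⨅ m, v m
  set T : ℕ → ℕ → E → ℝ := fun m n x => (nStep P n x).real (A m)ᶜ with hT
  have hTm : ∀ m n, Measurable (T m n) := fun m n =>
    (Kernel.measurable_coe (nStep P n) (hA m).compl).ennreal_toReal
  have hTi : ∀ m n, Integrable (T m n) μ := fun m n => integrable_of_abs_le (hTm m n) (C := 1)
    (fun x => by rw [abs_of_nonneg measureReal_nonneg]; exact measureReal_le_one) μ
  -- By invariance the `μ`-mean of `P_n(x, (A m)ᶜ)` is `μ (A m)ᶜ`, whatever `n` is.
  have hTμ : ∀ m n, ∫ x, T m n x ∂μ ≤ 1 / ((m : ℝ) + 1) := by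
    intro m n
    have h1 := integral_integral_nStep hμ (f := (A m)ᶜ.indicator 1) (C := 1)
      (measurable_one.indicator (hA m).compl) (fun x => by
        by_cases hx : x ∈ A m <;> simp [hx]) n
    simp_rw [integral_indicator_one (hA m).compl] at h1
    exact h1.le.trans (hAμ m)
  set Q : ℕ → ℕ → E × E → ℝ := fun m n z =>
    3 * (V m n z.1 + V m n z.2 + (1 / ((m : ℝ) + 1)) ^ 2 + (2 * C) ^ 2 * T m n z.1) with hQ
  have hQ0 : ∀ m n z, 0 ≤ Q m n z := fun m n z => by
    have := hV0 m n z.1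
    have := hV0 m n z.2
    have : 0 ≤ T m n z.1 := measureReal_nonneg
    positivity
  have hQm : ∀ m n, Measurable (Q m n) := fun m n => by
    have := hVm m n
    have := hTm m n
    fun_prop
  -- Replacing `v (m + n)` by its lower bound `L` makes the bound on the integral of `Q m n`
  -- independent of `n`.
  set q : ℕ → ℝ := fun m =>
    3 * ((v m - L) + (v m - L) + (1 / ((m : ℝ) + 1)) ^ 2 + (2 * C) ^ 2 * (1 / ((m : ℝ) + 1)))
    with hq
  have hqt : Tendsto q atTop (𝓝 0) := by
    have t1 : Tendsto (fun m => v m - L) atTop (𝓝 0) := by simpa using hvt.sub_const L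
    have t2 : Tendsto (fun m : ℕ => 1 / ((m : ℝ) + 1)) atTop (𝓝 0) :=
      tendsto_one_div_add_atTop_nhds_zero_nat
    have := (((t1.add t1).add (t2.pow 2)).add (t2.const_mul ((2 * C) ^ 2))).const_mul 3
    simp only [ne_eq, OfNat.ofNat_ne_zero, not_false_eq_true, zero_pow, add_zero, mul_zero] at this
    exact this
  have hQq : ∀ m n, ∫ z, Q m n z ∂(μ.prod μ) ≤ q m := by
    intro m n
    have j1 : Integrable (fun z : E × E => V m n z.1) (μ.prod μ) := (hVi m n).comp_fst μ
    have j2 : Integrable (fun z : E × E => V m n z.2) (μ.prod μ) := (hVi m n).comp_snd μ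
    have j3 : Integrable (fun z : E × E => (2 * C) ^ 2 * T m n z.1) (μ.prod μ) :=
      ((hTi m n).comp_fst μ).const_mul _
    have j4 : Integrable (fun z : E × E => V m n z.1 + V m n z.2) (μ.prod μ) := j1.add j2
    have j5 : Integrable (fun z : E × E => V m n z.1 + V m n z.2 + (1 / ((m : ℝ) + 1)) ^ 2)
      (μ.prod μ) := j4.add (integrable_const _)
    have hL : L ≤ v (m + n) := ciInf_le hbdd _
    have e1 : ∫ z, V m n z.1 ∂(μ.prod μ) = v m - v (m + n) := by
      rw [← hVv]; simpa using integral_fun_fst (μ := μ) (ν := μ) (V m n)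
    have e2 : ∫ z, V m n z.2 ∂(μ.prod μ) = v m - v (m + n) := by
      rw [← hVv]; simpa using integral_fun_snd (μ := μ) (ν := μ) (V m n)
    have e3 : ∫ z, T m n z.1 ∂(μ.prod μ) = ∫ x, T m n x ∂μ := by
      simpa using integral_fun_fst (μ := μ) (ν := μ) (T m n)
    simp only [hQ, hq]
    rw [integral_const_mul, integral_add j5 j3, integral_add j4 (integrable_const _),
      integral_add j1 j2, integral_const_mul, e1, e2, e3]
    have := mul_le_mul_of_nonneg_left (hTμ m n) (sq_nonneg (2 * C))
    simp only [integral_const, probReal_univ, one_smul]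
    linarith
  refine tendsto_lintegral_zero_of_eventually_le_mul (B := ENNReal.ofReal ((C + C) ^ 2))
    (R := fun m n z => ENNReal.ofReal (Q m n z)) (r := fun m => ENNReal.ofReal (q m))
    (fun n => ?_) ENNReal.ofReal_ne_top (fun n z => ?_) (fun m n => (hQm m n).ennreal_ofReal)
    (by simpa using ENNReal.tendsto_ofReal hqt) (fun m n => ?_) ?_
  · exact ((((hgm n).comp measurable_fst).sub ((hgm n).comp measurable_snd)).pow_const
      2).ennreal_ofReal
  · refine ENNReal.ofReal_le_ofReal ((le_abs_self _).trans (sq_le_of_abs_le ?_))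
    exact (abs_sub _ _).trans (add_le_add (hgC n z.1) (hgC n z.2))
  · rw [← ofReal_integral_eq_lintegral_ofReal _ (Eventually.of_forall (hQ0 m n))]
    · exact ENNReal.ofReal_le_ofReal (hQq m n)
    · exact (((((hVi m n).comp_fst μ).add ((hVi m n).comp_snd μ)).add (integrable_const _)).add
        (((hTi m n).comp_fst μ).const_mul _)).const_mul 3
  · filter_upwards [h] with z hz
    obtain ⟨a, ha, hz⟩ := hz.exists_coupling_nStep hd_cont.measurable
    -- The mass `a` depends on the pair `z`; its inverse is the pointwise constant allowed by the
    -- convergence lemma.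
    obtain ⟨j, hj⟩ := exists_nat_gt (1 / a)
    refine ⟨j, fun m => ?_⟩
    filter_upwards [hz (ε m) (hε m)] with n hn
    obtain ⟨ξ, hξ, hle⟩ := hn
    have key := mul_sq_sub_integral_le hd_cont.measurable (hgm m) (hgC m) hξ (hA m) (hAd m) hle
    rw [← integral_nStep_add hfm hC m n z.1, ← integral_nStep_add hfm hC m n z.2] at key
    have key' : a * (∫ u, f u ∂(nStep P (m + n) z.1) - ∫ u, f u ∂(nStep P (m + n) z.2)) ^ 2 ≤
      Q m n z := key
    rw [Nat.add_comm n m, ← ENNReal.ofReal_natCast, ← ENNReal.ofReal_mul (Nat.cast_nonneg j)]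
    refine ENNReal.ofReal_le_ofReal ?_
    have h1 : 1 ≤ j * a := by
      rw [div_lt_iff₀ ha] at hj
      exact hj.le
    have hs := sq_nonneg (∫ u, f u ∂(nStep P (m + n) z.1) - ∫ u, f u ∂(nStep P (m + n) z.2))
    calc _ ≤ (j * a) * (∫ u, f u ∂(nStep P (m + n) z.1)
              - ∫ u, f u ∂(nStep P (m + n) z.2)) ^ 2 := le_mul_of_one_le_left hs h1
      _ = j * (a * (∫ u, f u ∂(nStep P (m + n) z.1)
              - ∫ u, f u ∂(nStep P (m + n) z.2)) ^ 2) := by ring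
      _ ≤ j * Q m n z := by gcongr

/-- By invariance `∫ f dμ` is the `μ`-mean of `P_n f(y)`, so Jensen in `y` reduces this to the
two-point statement. -/
theorem tendsto_lintegral_sq_nStep_sub_integral {d : E → E → ℝ} (hd : IsMetric d)
    (hd_cont : Continuous fun z : E × E => d z.1 z.2) (hP : IsDFeller d P)
    {μ : Measure E} [IsProbabilityMeasure μ] (hμ : P.Invariant μ)
    (h : ∀ᵐ z ∂(μ.prod μ), CouplingCond d P z.1 z.2) {f : E → ℝ} {C : ℝ} (hC : ∀ x, |f x| ≤ C)
    (hf : DContinuous d f) :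
    Tendsto (fun n => ∫⁻ x, ENNReal.ofReal
      ((∫ u, f u ∂(nStep P n x) - ∫ u, f u ∂μ) ^ 2) ∂μ) atTop (𝓝 0) := by
  have hfm : Measurable f := (hf.continuous hd hd_cont).measurable
  refine tendsto_of_tendsto_of_tendsto_of_le_of_le tendsto_const_nhds
    (tendsto_lintegral_sq_sub_nStep hd hd_cont hP hμ h hC hf) (fun _ => zero_le) fun n => ?_
  have hgm := measurable_integral_nStep P hfm n
  have hgC : ∀ x, |∫ u, f u ∂(nStep P n x)| ≤ C := fun x => abs_integral_le hC _
  beta_reduce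
  have hm : Measurable fun z : E × E => ENNReal.ofReal
      ((∫ u, f u ∂(nStep P n z.1) - ∫ u, f u ∂(nStep P n z.2)) ^ 2) :=
    (((hgm.comp measurable_fst).sub (hgm.comp measurable_snd)).pow_const 2).ennreal_ofReal
  rw [lintegral_prod _ hm.aemeasurable]
  refine lintegral_mono fun x => ?_
  beta_reduce
  rw [← ofReal_integral_eq_lintegral_ofReal _ (Eventually.of_forall fun y => sq_nonneg _),
    ← integral_integral_nStep hμ hfm hC n]
  · exact ENNReal.ofReal_le_ofReal (sq_sub_integral_le hgm hgC μ _)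
  · exact integrable_of_abs_le (by fun_prop) (fun y => sq_le_of_abs_le
      ((abs_sub _ _).trans (add_le_add (hgC x) (hgC y)))) _

end Ergodic

/-! ### The minimal distance via partitions of unity. -/

section MinimalDist

variable {E : Type*} [MeasurableSpace E]

/-- Two measures that give nearly the same mass to each function of a partition of unity with
small supports are close in the minimal distance. -/
theorem minimalDist_le_of_partition {d : E → E → ℝ}
    (hd : Measurable fun z : E × E => d z.1 z.2) {C r : ℝ} (hC : ∀ x y, d x y ≤ C)
    {κ μ : Measure E} [IsProbabilityMeasure κ] [IsProbabilityMeasure μ]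
    {ι : Type*} (s : Finset ι) {φ : ι → E → ℝ≥0∞} (hφ : ∀ i, Measurable (φ i))
    (hsum : ∀ x, ∑ i ∈ s, φ i x ≤ 1)
    (hsupp : ∀ i ∈ s, ∀ x y, φ i x ≠ 0 → φ i y ≠ 0 → d x y ≤ r) :
    minimalDist d κ μ ≤ ENNReal.ofReal r +
      ENNReal.ofReal C * (1 - ∑ i ∈ s, min (∫⁻ x, φ i x ∂κ) (∫⁻ x, φ i x ∂μ)) := by
  set a : ι → ℝ≥0∞ := fun i => ∫⁻ x, φ i x ∂κ with ha
  set b : ι → ℝ≥0∞ := fun i => ∫⁻ x, φ i x ∂μ with hb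
  have hle1 : ∀ i ∈ s, ∀ x, φ i x ≤ 1 := fun i hi x =>
    (Finset.single_le_sum (f := fun i => φ i x) (fun _ _ => zero_le) hi).trans (hsum x)
  have hat : ∀ i ∈ s, a i ≠ ∞ := fun i hi =>
    ((lintegral_mono (hle1 i hi)).trans_lt (by simp)).ne
  have hbt : ∀ i ∈ s, b i ≠ ∞ := fun i hi =>
    ((lintegral_mono (hle1 i hi)).trans_lt (by simp)).ne
  -- The `i`-th pieces of `κ` and `μ` are matched by a product measure. The weight gives it mass
  -- `min (a i) (b i)` and keeps its marginals below the two pieces, so the sum over `s` extends to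
  -- a coupling.
  set ρ : ι → Measure (E × E) := fun i =>
    min (a i)⁻¹ (b i)⁻¹ • (κ.withDensity (φ i)).prod (μ.withDensity (φ i)) with hρ
  have hu₁ : ∀ i, κ.withDensity (φ i) Set.univ = a i := fun i => by
    rw [withDensity_apply _ .univ, Measure.restrict_univ]
  have hu₂ : ∀ i, μ.withDensity (φ i) Set.univ = b i := fun i => by
    rw [withDensity_apply _ .univ, Measure.restrict_univ]
  have dens : ∀ τ : Measure E, ∑ i ∈ s, τ.withDensity (φ i) ≤ τ := by
    intro τ
    refine Measure.le_iff.2 fun t ht => ?_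
    rw [Measure.finsetSum_apply]
    simp_rw [withDensity_apply _ ht]
    rw [← lintegral_finsetSum _ fun i _ => hφ i]
    exact (lintegral_mono hsum).trans (by simp)
  have hρ₁ : ∀ i ∈ s, (ρ i).fst ≤ κ.withDensity (φ i) := by
    intro i hi
    change Measure.map _ _ ≤ _
    rw [hρ, Measure.map_smul, Measure.map_fst_prod, hu₂, smul_smul]
    refine Measure.le_iff'.2 fun t => ?_
    rw [Measure.smul_apply, smul_eq_mul]
    refine mul_le_of_le_one_left zero_le ?_
    exact (mul_le_mul_left (min_le_right _ _) _).trans (ENNReal.inv_mul_le_one _)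
  have hρ₂ : ∀ i ∈ s, (ρ i).snd ≤ μ.withDensity (φ i) := by
    intro i hi
    change Measure.map _ _ ≤ _
    rw [hρ, Measure.map_smul, Measure.map_snd_prod, hu₁, smul_smul]
    refine Measure.le_iff'.2 fun t => ?_
    rw [Measure.smul_apply, smul_eq_mul]
    refine mul_le_of_le_one_left zero_le ?_
    exact (mul_le_mul_left (min_le_left _ _) _).trans (ENNReal.inv_mul_le_one _)
  have hmass : ∀ i ∈ s, ρ i Set.univ = min (a i) (b i) := by
    intro i hi
    rw [hρ, Measure.smul_apply, ← Set.univ_prod_univ, Measure.prod_prod, hu₁, hu₂, smul_eq_mul]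
    rcases eq_or_ne (a i) 0 with h0 | h0
    · simp [h0]
    rcases eq_or_ne (b i) 0 with h0' | h0'
    · simp [h0']
    rcases le_total (a i) (b i) with hab | hab
    · rw [min_eq_left hab, min_eq_right (ENNReal.inv_le_inv.2 hab), mul_comm (a i), ← mul_assoc,
        ENNReal.inv_mul_cancel h0' (hbt i hi), one_mul]
    · rw [min_eq_right hab, min_eq_left (ENNReal.inv_le_inv.2 hab), ← mul_assoc,
        ENNReal.inv_mul_cancel h0 (hat i hi), one_mul]
  have hset : MeasurableSet {z : E × E | d z.1 z.2 ≤ r} := measurableSet_le hd measurable_const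
  have hnull : ∀ i ∈ s, ρ i {z : E × E | d z.1 z.2 ≤ r}ᶜ = 0 := by
    intro i hi
    have hz : MeasurableSet {x | φ i x = 0} := hφ i (measurableSet_singleton 0)
    have z₀ : ∀ τ : Measure E, τ.withDensity (φ i) {x | φ i x = 0} = 0 := by
      intro τ
      rw [withDensity_apply _ hz, setLIntegral_congr_fun hz (g := fun _ => 0) fun x hx => hx]
      simp
    rw [hρ, Measure.smul_apply]
    have : (κ.withDensity (φ i)).prod (μ.withDensity (φ i)) {z : E × E | d z.1 z.2 ≤ r}ᶜ = 0 := by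
      refine measure_mono_null (t := {x | φ i x = 0} ×ˢ Set.univ ∪ Set.univ ×ˢ {x | φ i x = 0})
        (fun z hz => ?_) (measure_union_null ?_ ?_)
      · by_contra hcon
        simp only [Set.mem_union, Set.mem_prod, Set.mem_univ, and_true, true_and, not_or] at hcon
        exact hz (hsupp i hi _ _ hcon.1 hcon.2)
      · rw [Measure.prod_prod, z₀, zero_mul]
      · rw [Measure.prod_prod, z₀, mul_zero]
    rw [this, smul_zero]
  have hfst : (∑ i ∈ s, ρ i).fst ≤ κ := by
    refine le_trans ?_ (dens κ)
    refine Measure.le_iff.2 fun t ht => ?_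
    rw [Measure.fst_apply ht, Measure.finsetSum_apply, Measure.finsetSum_apply]
    refine Finset.sum_le_sum fun i hi => ?_
    rw [← Measure.fst_apply ht]
    exact Measure.le_iff'.1 (hρ₁ i hi) t
  have hsnd : (∑ i ∈ s, ρ i).snd ≤ μ := by
    refine le_trans ?_ (dens μ)
    refine Measure.le_iff.2 fun t ht => ?_
    rw [Measure.snd_apply ht, Measure.finsetSum_apply, Measure.finsetSum_apply]
    refine Finset.sum_le_sum fun i hi => ?_
    rw [← Measure.snd_apply ht]
    exact Measure.le_iff'.1 (hρ₂ i hi) t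
  obtain ⟨η, hη, hle⟩ := exists_coupling_ge hfst hsnd
  have hηp := hη.1
  have hηle : η {z : E × E | d z.1 z.2 ≤ r}ᶜ ≤ 1 - ∑ i ∈ s, min (a i) (b i) := by
    rw [prob_compl_eq_one_sub hset]
    refine tsub_le_tsub_left ?_ 1
    refine le_trans ?_ (Measure.le_iff'.1 hle _)
    rw [Measure.finsetSum_apply]
    refine Finset.sum_le_sum fun i hi => ?_
    rw [← hmass i hi, ← measure_add_measure_compl hset, hnull i hi, add_zero]
  refine (iInf₂_le η hη).trans ?_
  calc ∫⁻ z, ENNReal.ofReal (d z.1 z.2) ∂η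
      ≤ ∫⁻ z, (ENNReal.ofReal r +
          {z : E × E | d z.1 z.2 ≤ r}ᶜ.indicator (fun _ => ENNReal.ofReal C) z) ∂η := by
        refine lintegral_mono fun z => ?_
        by_cases hz : d z.1 z.2 ≤ r
        · exact le_add_right (ENNReal.ofReal_le_ofReal hz)
        · refine le_add_left ?_
          rw [Set.indicator_of_mem (by simpa using hz)]
          exact ENNReal.ofReal_le_ofReal (hC _ _)
    _ = ENNReal.ofReal r + ENNReal.ofReal C * η {z : E × E | d z.1 z.2 ≤ r}ᶜ := by
        rw [lintegral_add_left measurable_const, lintegral_indicator_const hset.compl]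
        simp
    _ ≤ _ := by gcongr

end MinimalDist

/-! ### A partition of unity made of `d`-Lipschitz functions. -/

section Bumps

variable {E : Type*}

/-- A cutoff function, equal to `1` on the `d`-ball of radius `r` around `c` and vanishing off the
ball of radius `2 r`. -/
noncomputable def bump (d : E → E → ℝ) (r : ℝ) (c x : E) : ℝ :=
  min 1 (max 0 (2 - d x c / r))

/-- The maximum of the cutoff functions around the first `k` points of a sequence. -/
noncomputable def bumpMax (d : E → E → ℝ) (r : ℝ) (c : ℕ → E) : ℕ → E → ℝ
  | 0 => fun _ => 0
  | k + 1 => fun x => max (bumpMax d r c k x) (bump d r (c k) x)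

variable {d : E → E → ℝ} {r : ℝ} {c : ℕ → E}

theorem bump_le_one (c x : E) : bump d r c x ≤ 1 := min_le_left _ _

theorem bump_eq_one (hr : 0 < r) {c x : E} (h : d x c ≤ r) : bump d r c x = 1 := by
  have : d x c / r ≤ 1 := (div_le_one hr).2 h
  exact min_eq_left (le_max_of_le_right (by linarith))

theorem dist_le_of_bump_pos (hr : 0 < r) {c x : E} (h : 0 < bump d r c x) : d x c ≤ 2 * r := by
  by_contra hlt
  have : 2 ≤ d x c / r := (le_div_iff₀ hr).2 (not_le.1 hlt).le
  rw [bump, max_eq_left (by linarith), min_eq_right zero_le_one] at h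
  exact h.false

theorem abs_bump_sub_le (hd : IsMetric d) (hr : 0 < r) (c x y : E) :
    |bump d r c x - bump d r c y| ≤ d x y / r := by
  have h1 : |bump d r c x - bump d r c y| ≤ |max 0 (2 - d x c / r) - max 0 (2 - d y c / r)| := by
    simpa [bump] using abs_min_sub_min_le_max (1 : ℝ) (max 0 (2 - d x c / r)) 1
      (max 0 (2 - d y c / r))
  have h2 : |max 0 (2 - d x c / r) - max 0 (2 - d y c / r)| ≤
      |(2 - d x c / r) - (2 - d y c / r)| := by
    simpa using abs_max_sub_max_le_max (0 : ℝ) (2 - d x c / r) 0 (2 - d y c / r)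
  refine h1.trans (h2.trans ?_)
  have e : (2 - d x c / r) - (2 - d y c / r) = (d y c - d x c) / r := by ring
  rw [e, abs_div, abs_of_pos hr]
  gcongr
  rw [abs_le]
  have t1 := hd.triangle x y c
  have t2 := hd.triangle y x c
  rw [hd.symm y x] at t2
  constructor <;> linarith

theorem bumpMax_nonneg (k : ℕ) (x : E) : 0 ≤ bumpMax d r c k x := by
  induction k with
  | zero => exact le_rfl
  | succ k ih => exact le_max_of_le_left ih

theorem bumpMax_le_one (k : ℕ) (x : E) : bumpMax d r c k x ≤ 1 := by
  induction k with
  | zero => exact zero_le_one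
  | succ k ih => exact max_le ih (bump_le_one _ _)

theorem bumpMax_le_succ (k : ℕ) (x : E) : bumpMax d r c k x ≤ bumpMax d r c (k + 1) x :=
  le_max_left _ _

theorem abs_bumpMax_sub_le (hd : IsMetric d) (hr : 0 < r) (k : ℕ) (x y : E) :
    |bumpMax d r c k x - bumpMax d r c k y| ≤ d x y / r := by
  induction k with
  | zero => simpa [bumpMax] using div_nonneg (hd.nonneg x y) hr.le
  | succ k ih =>
    exact (abs_max_sub_max_le_max _ _ _ _).trans (max_le ih (abs_bump_sub_le hd hr _ x y))

theorem DContinuous.of_lipschitz {f : E → ℝ} {K : ℝ} (hK : 0 < K)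
    (h : ∀ x y, |f x - f y| ≤ K * d x y) : DContinuous d f := by
  intro x ε hε
  refine ⟨ε / K, by positivity, fun y hy => ?_⟩
  rw [abs_sub_comm]
  refine (h x y).trans_lt ?_
  rw [lt_div_iff₀ hK] at hy
  linarith

/-- The increments of the running maximum telescope, so they form the partition of unity. Each is `2
/ r`-Lipschitz for `d` and hence an admissible test function. -/
theorem dContinuous_bumpMax_diff (hd : IsMetric d) (hr : 0 < r) (k : ℕ) :
    DContinuous d fun x => bumpMax d r c (k + 1) x - bumpMax d r c k x := by
  refine DContinuous.of_lipschitz (K := 2 / r) (by positivity) fun x y => ?_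
  have h1 := abs_bumpMax_sub_le (c := c) hd hr (k + 1) x y
  have h2 := abs_bumpMax_sub_le (c := c) hd hr k x y
  calc _ = |(bumpMax d r c (k + 1) x - bumpMax d r c (k + 1) y) -
        (bumpMax d r c k x - bumpMax d r c k y)| := by congr 1; ring
    _ ≤ d x y / r + d x y / r := (abs_sub _ _).trans (add_le_add h1 h2)
    _ = _ := by ring

/-- The maximum can only grow at a point where the new cutoff function is positive. -/
theorem dist_le_of_bumpMax_lt (hr : 0 < r) {k : ℕ} {x : E}
    (h : 0 < bumpMax d r c (k + 1) x - bumpMax d r c k x) : d x (c k) ≤ 2 * r := by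
  refine dist_le_of_bump_pos hr ?_
  by_contra h0
  have h1 : bump d r (c k) x ≤ bumpMax d r c k x := (not_lt.1 h0).trans (bumpMax_nonneg k x)
  have h2 : bumpMax d r c (k + 1) x = bumpMax d r c k x := max_eq_left h1
  linarith

/-- The `d`-ball around `x` is open in the given topology, so the dense sequence enters it, and from
then on the maximum at `x` equals `1`. -/
theorem tendsto_bumpMax [TopologicalSpace E] (hd : IsMetric d)
    (hd_cont : Continuous fun z : E × E => d z.1 z.2) (hr : 0 < r) (hc : DenseRange c) (x : E) :
    Tendsto (fun k => bumpMax d r c k x) atTop (𝓝 1) := by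
  have ho : IsOpen {y | d x y < r} :=
    isOpen_lt (hd_cont.comp (Continuous.prodMk_right x)) continuous_const
  obtain ⟨j, hj⟩ := hc.exists_mem_open ho ⟨x, by simpa [hd.self] using hr⟩
  have hmono : Monotone fun k => bumpMax d r c k x := monotone_nat_of_le_succ fun k =>
    bumpMax_le_succ k x
  refine tendsto_const_nhds.congr' ?_
  filter_upwards [eventually_ge_atTop (j + 1)] with k hk
  refine le_antisymm ?_ (bumpMax_le_one k x)
  refine le_trans ?_ (hmono hk)
  exact (bump_eq_one hr (le_of_lt hj)).symm.le.trans (le_max_right _ _)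

end Bumps

/-! ### From test functions to the minimal distance. -/

theorem tendsto_measure_minimalDist {E : Type*} [TopologicalSpace E] [SecondCountableTopology E]
    [MeasurableSpace E] [BorelSpace E] {P : Kernel E E} [IsMarkovKernel P] {d : E → E → ℝ}
    (hd : IsMetric d) {C : ℝ} (hC : ∀ x y, d x y ≤ C)
    (hd_cont : Continuous fun z : E × E => d z.1 z.2) (hP : IsDFeller d P)
    {μ : Measure E} [IsProbabilityMeasure μ] (hμ : P.Invariant μ)
    (h : ∀ᵐ z ∂(μ.prod μ), CouplingCond d P z.1 z.2) {ε : ℝ} (hε : 0 < ε) :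
    Tendsto (fun n => μ {x | ENNReal.ofReal ε < minimalDist d (nStep P n x) μ}) atTop (𝓝 0) := by
  have hne : Nonempty E := nonempty_of_isProbabilityMeasure μ
  have hC0 : 0 ≤ C := (hd.nonneg hne.some hne.some).trans (hC _ _)
  obtain ⟨c, hc⟩ := TopologicalSpace.exists_dense_seq E
  -- Points in the support of one `ψ k` are within `4 * r = ε / 2` of each other; the unmatched mass
  -- may cost the other `ε / 2`.
  set r := ε / 8 with hrdef
  have hr : 0 < r := by positivity
  set ψ : ℕ → E → ℝ := fun k x => bumpMax d r c (k + 1) x - bumpMax d r c k x with hψ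
  have hψ0 : ∀ k x, 0 ≤ ψ k x := fun k x => sub_nonneg.2 (bumpMax_le_succ k x)
  have hψ1 : ∀ k x, |ψ k x| ≤ 1 := fun k x => by
    rw [abs_of_nonneg (hψ0 k x)]
    have := bumpMax_le_one (d := d) (r := r) (c := c) (k + 1) x
    have := bumpMax_nonneg (d := d) (r := r) (c := c) k x
    simp only [hψ]
    linarith
  have hψd : ∀ k, DContinuous d (ψ k) := fun k => dContinuous_bumpMax_diff hd hr k
  have hψm : ∀ k, Measurable (ψ k) := fun k => ((hψd k).continuous hd hd_cont).measurable
  have hψsum : ∀ K x, ∑ k ∈ Finset.range K, ψ k x = bumpMax d r c K x := fun K x => by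
    simp only [hψ]
    rw [Finset.sum_range_sub (fun k => bumpMax d r c k x)]
    simp [bumpMax]
  have hMm : ∀ K, Measurable (bumpMax d r c K) := fun K => by
    have : bumpMax d r c K = fun x => ∑ k ∈ Finset.range K, ψ k x := funext fun x => (hψsum K x).symm
    rw [this]
    exact Finset.measurable_fun_sum _ fun k _ => hψm k
  -- At most `2 * θ` of mass stays unmatched: `θ` because only `K` functions are kept, and `θ` from
  -- `K` errors of size `t`. The cost `C * (2 * θ)` is at most `ε / 2`.
  set θ := ε / (4 * (C + 1)) with hθdef
  have hθ : 0 < θ := by positivity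
  have hMt : Tendsto (fun K => ∫ x, bumpMax d r c K x ∂μ) atTop (𝓝 1) := by
    have := tendsto_integral_of_dominated_convergence (μ := μ) (F := fun K => bumpMax d r c K)
      (f := fun _ => (1 : ℝ)) (fun _ => 1) (fun K => (hMm K).aestronglyMeasurable)
      (integrable_const _) (fun K => Eventually.of_forall fun x => by
        rw [Real.norm_eq_abs, abs_of_nonneg (bumpMax_nonneg K x)]; exact bumpMax_le_one K x)
      (Eventually.of_forall fun x => tendsto_bumpMax hd hd_cont hr hc x)
    simpa using this
  obtain ⟨K, hK⟩ := (hMt.eventually_const_lt (show 1 - θ < 1 by linarith)).exists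
  set t := θ / (K + 1) with htdef
  have ht : 0 < t := by positivity
  have hKt : K * t ≤ θ := by
    rw [htdef, mul_div_assoc', div_le_iff₀ (by positivity)]
    nlinarith
  have hψi : ∀ k (τ : Measure E) [IsProbabilityMeasure τ], Integrable (ψ k) τ :=
    fun k τ _ => integrable_of_abs_le (hψm k) (hψ1 k) τ
  have hof : ∀ k (τ : Measure E) [IsProbabilityMeasure τ],
      ∫⁻ x, ENNReal.ofReal (ψ k x) ∂τ = ENNReal.ofReal (∫ x, ψ k x ∂τ) := fun k τ _ =>
    (ofReal_integral_eq_lintegral_ofReal (hψi k τ) (Eventually.of_forall (hψ0 k))).symm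
  have hclose : ∀ (κ : Measure E) [IsProbabilityMeasure κ],
      (∀ k ∈ Finset.range K, |∫ x, ψ k x ∂κ - ∫ x, ψ k x ∂μ| < t) →
      minimalDist d κ μ ≤ ENNReal.ofReal ε := by
    intro κ _ hκ
    have hb := minimalDist_le_of_partition (κ := κ) (μ := μ) hd_cont.measurable hC (r := 4 * r)
      (Finset.range K) (φ := fun k x => ENNReal.ofReal (ψ k x))
      (fun k => (hψm k).ennreal_ofReal) (fun x => by
        rw [← ENNReal.ofReal_sum_of_nonneg fun k _ => hψ0 k x, hψsum]
        exact ENNReal.ofReal_le_one.2 (bumpMax_le_one K x))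
      (fun k _ x y hx hy => by
        have hx' := dist_le_of_bumpMax_lt (d := d) (c := c) hr
          (ENNReal.ofReal_pos.1 (pos_iff_ne_zero.2 hx))
        have hy' := dist_le_of_bumpMax_lt (d := d) (c := c) hr
          (ENNReal.ofReal_pos.1 (pos_iff_ne_zero.2 hy))
        have := hd.triangle x (c k) y
        rw [hd.symm (c k) y] at this
        linarith)
    refine hb.trans ?_
    have hmin : ∀ k, min (∫⁻ x, ENNReal.ofReal (ψ k x) ∂κ) (∫⁻ x, ENNReal.ofReal (ψ k x) ∂μ) =
        ENNReal.ofReal (min (∫ x, ψ k x ∂κ) (∫ x, ψ k x ∂μ)) := fun k => by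
      rw [hof, hof, ENNReal.ofReal_min]
    simp_rw [hmin]
    have hmin0 : ∀ k ∈ Finset.range K, 0 ≤ min (∫ x, ψ k x ∂κ) (∫ x, ψ k x ∂μ) := fun k _ =>
      le_min (integral_nonneg (hψ0 k)) (integral_nonneg (hψ0 k))
    have hsumμ : ∑ k ∈ Finset.range K, ∫ x, ψ k x ∂μ = ∫ x, bumpMax d r c K x ∂μ := by
      rw [← integral_finsetSum _ fun k _ => hψi k μ]
      simp_rw [hψsum]
    have hge : 1 - 2 * θ ≤ ∑ k ∈ Finset.range K, min (∫ x, ψ k x ∂κ) (∫ x, ψ k x ∂μ) := by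
      have : ∑ k ∈ Finset.range K, (∫ x, ψ k x ∂μ - t) ≤
          ∑ k ∈ Finset.range K, min (∫ x, ψ k x ∂κ) (∫ x, ψ k x ∂μ) := by
        refine Finset.sum_le_sum fun k hk => le_min ?_ (by linarith)
        have := (abs_lt.1 (hκ k hk)).1
        linarith
      rw [Finset.sum_sub_distrib, hsumμ, Finset.sum_const, Finset.card_range, nsmul_eq_mul] at this
      linarith
    have hle : ∑ k ∈ Finset.range K, min (∫ x, ψ k x ∂κ) (∫ x, ψ k x ∂μ) ≤ 1 := by
      refine (Finset.sum_le_sum fun k _ => min_le_right _ _).trans ?_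
      rw [hsumμ]
      exact (le_abs_self _).trans (abs_integral_le (fun x => by
        rw [abs_of_nonneg (bumpMax_nonneg K x)]; exact bumpMax_le_one K x) μ)
    rw [← ENNReal.ofReal_sum_of_nonneg hmin0, ← ENNReal.ofReal_one,
      ← ENNReal.ofReal_sub _ (Finset.sum_nonneg hmin0), ← ENNReal.ofReal_mul hC0,
      ← ENNReal.ofReal_add (by positivity) (mul_nonneg hC0 (sub_nonneg.2 hle))]
    refine ENNReal.ofReal_le_ofReal ?_
    have h1 : C * (1 - ∑ k ∈ Finset.range K, min (∫ x, ψ k x ∂κ) (∫ x, ψ k x ∂μ)) ≤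
        C * (2 * θ) := mul_le_mul_of_nonneg_left (by linarith) hC0
    have h2 : C * (2 * θ) ≤ ε / 2 := by
      have : θ * (C + 1) = ε / 4 := by rw [hθdef]; field_simp
      nlinarith
    linarith
  have hbound : ∀ n, μ {x | ENNReal.ofReal ε < minimalDist d (nStep P n x) μ} ≤
      ∑ k ∈ Finset.range K, (∫⁻ x, ENNReal.ofReal
        ((∫ u, ψ k u ∂(nStep P n x) - ∫ u, ψ k u ∂μ) ^ 2) ∂μ) / ENNReal.ofReal (t ^ 2) := by
    intro n
    -- If the distance exceeds `ε`, one of the `K` test integrals is off by at least `t`; a union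
    -- bound and Chebyshev's inequality then reduce the claim to `L²` convergence.
    have hsub : {x | ENNReal.ofReal ε < minimalDist d (nStep P n x) μ} ⊆
        ⋃ k ∈ Finset.range K, {x | ENNReal.ofReal (t ^ 2) ≤ ENNReal.ofReal
          ((∫ u, ψ k u ∂(nStep P n x) - ∫ u, ψ k u ∂μ) ^ 2)} := by
      intro x hx
      by_contra hcon
      refine (not_lt.2 (hclose (nStep P n x) fun k hk => ?_)) hx
      by_contra hlt
      refine hcon (Set.mem_iUnion₂.2 ⟨k, hk, ENNReal.ofReal_le_ofReal ?_⟩)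
      rw [← sq_abs (∫ u, ψ k u ∂(nStep P n x) - ∫ u, ψ k u ∂μ)]
      exact pow_le_pow_left₀ ht.le (not_lt.1 hlt) 2
    refine (measure_mono hsub).trans ((measure_biUnion_finset_le _ _).trans
      (Finset.sum_le_sum fun k _ => ?_))
    exact meas_ge_le_lintegral_div
      (((measurable_integral_nStep P (hψm k) n).sub_const _).pow_const 2).ennreal_ofReal.aemeasurable
      (ENNReal.ofReal_pos.2 (by positivity)).ne' ENNReal.ofReal_ne_top
  refine tendsto_of_tendsto_of_tendsto_of_le_of_le tendsto_const_nhds ?_ (fun _ => zero_le) hbound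
  have hlim : ∀ k ∈ Finset.range K, Tendsto (fun n => (∫⁻ x, ENNReal.ofReal
      ((∫ u, ψ k u ∂(nStep P n x) - ∫ u, ψ k u ∂μ) ^ 2) ∂μ) / ENNReal.ofReal (t ^ 2))
      atTop (𝓝 0) := fun k _ => by
    simpa using ENNReal.Tendsto.div_const
      (tendsto_lintegral_sq_nStep_sub_integral hd hd_cont hP hμ h (hψ1 k) (hψd k))
      (Or.inr (ENNReal.ofReal_pos.2 (by positivity : 0 < t ^ 2)).ne')
  simpa using tendsto_finsetSum _ hlim

end GenCoupling

theorem theorem2p3 {E : Type*} [TopologicalSpace E] [PolishSpace E] [MeasurableSpace E]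
    [BorelSpace E] (P : Kernel E E) [IsMarkovKernel P]
    (d : E → E → ℝ) (hd : GenCoupling.IsMetric d) (hd_bdd : ∃ C, ∀ x y, d x y ≤ C)
    (hd_cont : Continuous fun z : E × E => d z.1 z.2) :
    (∀ (μ : Measure E) [IsProbabilityMeasure μ], GenCoupling.IsDFeller d P → P.Invariant μ →
      ∀ M : Set (E × E), MeasurableSet M → (μ.prod μ) M = 1 →
      (∀ z ∈ M, GenCoupling.CouplingCond d P z.1 z.2) →
      ∀ ε : ℝ, 0 < ε →
        Tendsto (fun n : ℕ =>
          μ {x | ENNReal.ofReal ε < GenCoupling.minimalDist d (GenCoupling.nStep P n x) μ})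
          atTop (𝓝 0)) ∧
    (∀ x y : E,
      (GenCoupling.CouplingCond d P x y ↔
        ∃ p R : ℝ, 1 < p ∧ 1 ≤ R ∧ GenCoupling.LpCouplingCond d P p R x y) ∧
      (GenCoupling.GenCouplingCond d P x y →
        (∃ p R : ℝ, 1 < p ∧ 1 ≤ R ∧ GenCoupling.LpCouplingCond d P p R x y) ∧
        GenCoupling.CouplingCond d P x y)) := by
  obtain ⟨C, hC⟩ := hd_bdd
  refine ⟨?_, fun x y => ⟨⟨fun h => ⟨2, 1, one_lt_two, le_rfl, h.lpCouplingCond le_rfl⟩, ?_⟩,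
    fun h => ⟨⟨2, 1, one_lt_two, le_rfl, h.couplingCond.lpCouplingCond le_rfl⟩,
      h.couplingCond⟩⟩⟩
  · intro μ _ hP hμ M hM hM1 hMc ε hε
    have hae : ∀ᵐ z ∂(μ.prod μ), z ∈ M := (prob_compl_eq_zero_iff hM).2 hM1
    exact GenCoupling.tendsto_measure_minimalDist hd hC hd_cont hP hμ
      (hae.mono fun z hz => hMc z hz) hε
  · rintro ⟨p, R, hp, -, h⟩
    exact h.couplingCond hp
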